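/- Let $s\in(0,\tfrac12)\cup(\tfrac12,1)$, $L>0$, $\delta>0$ and $\alpha\in(\max(0,2s-1),1]$. Let $g\in L^\infty(\mathbb R)$ have bounded support and vanish in $(-L,L)$, and let $u:\mathbb R\to\mathbb R$ solve the inhomogeneous fractional Dirichlet problem $$(-\Delta)^s u(x):=c_{s}\,\mathrm{P.V.}\!\int_{\mathbb R}\frac{u(x)-u(y)}{|x-y|^{1+2s}}\,dy=f(x)\quad (|x|<L),\qquad u=g\quad\text{outside }[-L,L],\qquad c_{s}=\frac{2^{2s}s\,\Gamma(\frac12+s)}{\sqrt\pi\,\Gamma(1-s)},$$ with $u\in C^{1,\alpha}([-L-\delta,L+\delta])$. **Scheme.** For $N\in\mathbb N$, $N\ge1$, put $h=2L/N$, $x_i=-L+ih$, $u_i=u(x_i)$, $\bar\phi(y)=\max(1-|y|/h,0)$, $\phi_i(y)=\bar\phi(y-x_i)\chi_{[-L,L]}(y)$, $\kappa=-c_{s-1}=-\frac{2^{2s-2}(s-1)\Gamma(s-\frac12)}{\sqrt\pi\,\Gamma(2-s)}$, and $((-\Delta)_hv)_i=-(v_{i-1}-2v_i+v_{i+1})/h^2$.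 For $k\in\mathbb Z$ let $$\bar\omega_k=\kappa\int_{-h}^{h}|kh-y|^{1-2s}\bar\phi(y)\,dy,\qquad w_k=(-\Delta)_h\bar\omega_k .$$ Let $\bar\omega^M_k=\bar\omega_k$ for $k\neq0$, let $\bar\omega_0^M=0$ if $w_1\ge0$ and $\bar\omega_0^M=\bar\omega_0$ if $w_1<0$, and let $w^M_k=(-\Delta)_h\bar\omega^M_k$. For $0\le i\le N$ let $$R_i=\kappa\int_{\mathbb R}|x_i-y|^{1-2s}\bigl(u_0\phi_0(y)+u_N\phi_N(y)+g(y)\bigr)dy,$$ and let $R^M_i=R_i$ for $0<i<N$, $R^M_i=R_i+(\bar\omega_0^M-\bar\omega_0)u_i$ for $i\in\{0,N\}$ (so $R^M=R$ whenever $w_1<0$ or $u(\pm L)=0$). Let $$\mathbf B_1=\bigl(w^M_{|i-j|}\bigr)_{i,j=1}^{N-1},\quad \mathbf U=(u(x_i))_{i=1}^{N-1},\quad \mathbf G=\bigl((-\Delta)_hR^M_i\bigr)_{i=1}^{N-1},\quad \mathbf F=(f(x_i))_{i=1}^{N-1}.$$ **Theorem.** There is a constant $C>0$, independent of $N$, such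 that for every $N\ge1$ with $4h<\delta$ the system $\mathbf B_1\mathbf U_h+\mathbf G=\mathbf F$ has exactly one solution $\mathbf U_h$, and $$\|\mathbf U-\mathbf U_h\|_\infty< Ch^{1+\alpha-2s},\qquad \|\mathbf U-\mathbf U_h\|_2< Ch^{1+\alpha-2s},$$ where $\|v\|_\infty=\max_i|v_i|$ and $\|v\|_2=(h\sum_i v_i^2)^{1/2}$ are the discrete $l^\infty$ and $l^2$ norms. -/

import Mathlib

open Set Filter Topology MeasureTheory
open scoped NNReal

noncomputable section

namespace FracDirichlet

/-- `2^{2s} s Γ(1/2+s) / (π^{1/2} Γ(1-s))`: for `0 < s < 1` this is the constant `c_{1,s}` of the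
one-dimensional integral fractional Laplacian of order `s`. -/
def fracConst (s : ℝ) : ℝ :=
  (2 : ℝ) ^ (2 * s) * s * Real.Gamma (1 / 2 + s) / (Real.pi ^ (1 / 2 : ℝ) * Real.Gamma (1 - s))

/-- The constant `c_{1,s'}` with `s' = s - 1 < 0`, in front of the kernel `|x - y|^{-2s'-1}
= |x - y|^{1-2s}` of the operator `(-Δ)^{s-1}` (note the sign convention for negative orders). -/
def rieszConst (s : ℝ) : ℝ := -fracConst (s - 1)

/-- `HasFracLaplacianAt s u x l`: the integral fractional Laplacian
`c_{1,s} P.V. ∫ (u x - u y) / |x - y|^{1+2s} dy` exists at `x` and equals `l`. -/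
def HasFracLaplacianAt (s : ℝ) (u : ℝ → ℝ) (x l : ℝ) : Prop :=
  (∀ ε > 0, IntegrableOn (fun y => (u x - u y) / |x - y| ^ (1 + 2 * s)) {y | ε < |x - y|}) ∧
  Tendsto
    (fun ε : ℝ => fracConst s * ∫ y in {y | ε < |x - y|}, (u x - u y) / |x - y| ^ (1 + 2 * s))
    (𝓝[>] 0) (𝓝 l)

/-- `u` solves `(-Δ)^s u = f` in `(-L, L)`, `u = g` outside `[-L, L]`. -/
def IsDirichletSolution (s L : ℝ) (f g u : ℝ → ℝ) : Prop :=
  (∀ x ∈ Ioo (-L) L, HasFracLaplacianAt s u x (f x)) ∧ ∀ x, x ∉ Icc (-L) L → u x = g x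

/-- `u ∈ C^{1,α}([a, b])`. -/
def IsC1Holder (α : ℝ≥0) (u : ℝ → ℝ) (a b : ℝ) : Prop :=
  ContDiffOn ℝ 1 u (Icc a b) ∧ ∃ K : ℝ≥0, HolderOnWith K α (derivWithin u (Icc a b)) (Icc a b)

/-- The mesh size `h = 2L/N`. -/
def meshSize (L : ℝ) (N : ℕ) : ℝ := 2 * L / N

/-- The grid points `x_i = -L + i h`, `i ∈ ℤ`. -/
def node (L : ℝ) (N : ℕ) (i : ℤ) : ℝ := -L + i * meshSize L N

/-- The hat function `1 - |y|/h` on `(-h, h)`, zero elsewhere. -/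
def hat (h y : ℝ) : ℝ := if |y| < h then 1 - |y| / h else 0

/-- The nodal basis function `φ_i`: the hat centred at `x_i`, cut off to
`[x_{i-1}, x_{i+1}] ∩ [-L, L]`. -/
def nodalBasis (L : ℝ) (N : ℕ) (i : ℤ) : ℝ → ℝ :=
  (Icc (node L N (i - 1)) (node L N (i + 1)) ∩ Icc (-L) L).indicator
    fun y => hat (meshSize L N) (y - node L N i)

/-- The discrete Laplacian `((-Δ)_h v)_i = -(v_{i-1} - 2 v_i + v_{i+1}) / h²`. -/
def discNegLaplacian (h : ℝ) (v : ℤ → ℝ) (i : ℤ) : ℝ :=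
  -(v (i - 1) - 2 * v i + v (i + 1)) / h ^ 2

/-- `ω̄_k = c_{1,s-1} ∫_{-h}^{h} |k h - y|^{1-2s} (1 - |y|/h) dy`. -/
def omegaBar (s h : ℝ) (k : ℤ) : ℝ :=
  rieszConst s * ∫ y in (-h)..h, |k * h - y| ^ (1 - 2 * s) * hat h y

/-- The unmodified weights `w_i = (-Δ)_h ω̄_i`. -/
def weight (s h : ℝ) (i : ℤ) : ℝ := discNegLaplacian h (omegaBar s h) i

open Classical in
/-- `ω̄^M`: equal to `ω̄`, except that `ω̄_0` is replaced by `0` if `w_1 ≥ 0`. -/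
def omegaBarM (s h : ℝ) (k : ℤ) : ℝ :=
  if k = 0 ∧ 0 ≤ weight s h 1 then 0 else omegaBar s h k

/-- The modified weights `w^M_i = (-Δ)_h ω̄^M_i`; the modification only affects `|i| ≤ 1`. -/
def weightM (s h : ℝ) (i : ℤ) : ℝ := discNegLaplacian h (omegaBarM s h) i

/-- `R_i = c_{1,s-1} ∫_ℝ |x_i - y|^{1-2s} (u_0 φ_0(y) + u_N φ_N(y) + g(y)) dy`, the contribution of
the boundary and exterior values to `(-Δ)^{s-1}_h u (x_i)`. -/
def remainder (s L : ℝ) (N : ℕ) (g u : ℝ → ℝ) (i : ℤ) : ℝ :=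
  rieszConst s * ∫ y, |node L N i - y| ^ (1 - 2 * s) *
    (u (node L N 0) * nodalBasis L N 0 y + u (node L N N) * nodalBasis L N N y + g y)

/-- The remainder of the modified scheme: the same replacement of `ω̄_0` by `ω̄^M_0`, i.e. the
addition of `(ω̄^M_0 - ω̄_0) u_i` to `(-Δ)^{s-1}_h u (x_i)`, at the two boundary nodes `i = 0`,
`i = N`, whose values are carried by the remainder. For `0 < i < N` the remainder is unchanged. -/
def remainderM (s L : ℝ) (N : ℕ) (g u : ℝ → ℝ) (i : ℤ) : ℝ :=
  remainder s L N g u i +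
    if i = 0 ∨ i = N then
      (omegaBarM s (meshSize L N) 0 - omegaBar s (meshSize L N) 0) * u (node L N i)
    else 0

/-- The symmetric Toeplitz matrix `B₁` with `b_i = w^M_i`, rows and columns `1, …, N-1`. -/
def schemeMatrix (s L : ℝ) (N : ℕ) : Matrix (Fin (N - 1)) (Fin (N - 1)) ℝ :=
  Matrix.of fun i j => weightM s (meshSize L N) |(i : ℤ) - (j : ℤ)|

/-- The nodal values `(v(x_i))_{i=1}^{N-1}`. -/
def nodalValues (L : ℝ) (N : ℕ) (v : ℝ → ℝ) : Fin (N - 1) → ℝ :=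
  fun i => v (node L N ((i : ℤ) + 1))

/-- The vector `G = ((-Δ)_h R^M_i)_{i=1}^{N-1}`. -/
def boundaryVector (s L : ℝ) (N : ℕ) (g u : ℝ → ℝ) : Fin (N - 1) → ℝ :=
  fun i => discNegLaplacian (meshSize L N) (remainderM s L N g u) ((i : ℤ) + 1)

/-- The discrete `l²` norm `(h ∑ v_i²)^{1/2}` of a grid function. -/
def discL2Norm {m : ℕ} (h : ℝ) (v : Fin m → ℝ) : ℝ := Real.sqrt (h * ∑ i, v i ^ 2)

end FracDirichlet

end

open FracDirichlet

/-!
The convergence proof is "consistency plus stability", and both halves rest on one kernel. The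
scheme is the discrete Laplacian `(-Δ)_h` applied to the convolution of the Riesz kernel
`κ |t|^{1-2s}` with the piecewise linear interpolant of `u`, extended by `g`
(`schemeMatrix_mulVec_add`). Moving `(-Δ)_h` onto the kernel produces `h^{-1-2s} dkern s (t / h)`,
where `dkern s` is the second difference of the Riesz kernel with step one; by homogeneity all
powers of `h` are explicit and every constant is an integral that does not involve `h`.

*Consistency* (`exists_residual_bound`). The function `dkern s` is even, integrable
(`integrable_dkern`) and of mean zero (`integral_dkern`), and it agrees with the kernel
`-c_s |t|^{-1-2s}` of the fractional Laplacian up to `O(|t|^{-3-2s})` (`exists_dkern_add_bound`).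
Three errors arise, each of order `h^{1+α-2s}`. The interpolation error is `O(h^{1+α})`, and the
discrete operator has norm `O(h^{-2s})` on bounded functions. The discrete operator and the
truncated fractional Laplacian both annihilate constants, so by symmetry their difference at `x`
sees only `2 u(x) - u(x-z) - u(x+z) = O(|z|^{1+α})`; after scaling, the resulting integral is finite
because `2s - 1 < α ≤ 1`, and it is uniform in the truncation radius (`abs_truncated_sub_le`).
Finally, the modified central weight contributes `O(h^{2-2s})` times a second difference quotient of
`u`, which is `O(h^{α-1})`.

*Stability* (`exists_stability`). The off-diagonal weights are nonpositive (`weightM_nonpos`): away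
from the diagonal by convexity of `κ t^{1-2s}` on `t > 0`, and next to the diagonal thanks to the
modification, through two elementary inequalities between `2 ^ p` and `3 ^ p` with `p = 3 - 2s`. The
row sums telescope to first differences of `ω̄^M`, hence are bounded below by a constant multiple of
`L^{-2s}` (`le_sum_schemeMatrix`). The discrete maximum principle (`norm_le_norm_mulVec`) then
bounds the inverse matrix in the supremum norm independently of `N`, and the discrete `l²` norm is
at most `(2L)^{1/2}` times the supremum norm.
-/

namespace FracDirichlet

/-! ### The constants -/

theorem fracConst_pos {s : ℝ} (hs0 : 0 < s) (hs1 : s < 1) : 0 < fracConst s := by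
  unfold fracConst
  have h1 : 0 < Real.Gamma (1 / 2 + s) := Real.Gamma_pos_of_pos (by linarith)
  have h2 : 0 < Real.Gamma (1 - s) := Real.Gamma_pos_of_pos (by linarith)
  have := Real.pi_pos
  positivity

/-- The functional equation of `Γ` relates the constants of orders `s` and `s - 1`: it makes
`-(κ |x|^{1-2s})''` equal to `-c_s |x|^{-1-2s}` away from the origin. -/
theorem rieszConst_mul {s : ℝ} (hs1 : s < 1) (hs : s ≠ 1 / 2) :
    rieszConst s * (2 * s * (2 * s - 1)) = fracConst s := by
  have hs' : s - 1 / 2 ≠ 0 := sub_ne_zero.2 hs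
  have hs'' : 1 - s ≠ 0 := by linarith
  have h1 : Real.Gamma (1 / 2 + s) = (s - 1 / 2) * Real.Gamma (s - 1 / 2) := by
    rw [← Real.Gamma_add_one hs']; congr 1; ring
  have h2 : Real.Gamma (1 - (s - 1)) = (1 - s) * Real.Gamma (1 - s) := by
    rw [← Real.Gamma_add_one hs'']; congr 1; ring
  have h3 : (2 : ℝ) ^ (2 * s) = 4 * (2 : ℝ) ^ (2 * (s - 1)) := by
    rw [show 2 * s = 2 * (s - 1) + 2 by ring, Real.rpow_add two_pos]; norm_num; ring
  have h4 : Real.Gamma (1 - s) ≠ 0 := (Real.Gamma_pos_of_pos (by linarith)).ne'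
  have h5 : (Real.pi : ℝ) ^ (1 / 2 : ℝ) ≠ 0 := (Real.rpow_pos_of_pos Real.pi_pos _).ne'
  unfold rieszConst fracConst
  rw [h1, h2, h3, show 1 / 2 + (s - 1) = s - 1 / 2 by ring]
  field_simp
  ring

/-! ### The Riesz kernel and its second difference -/

/-- The Riesz kernel `κ |t|^{1-2s}` of `(-Δ)^{s-1}`. -/
noncomputable def kern (s t : ℝ) : ℝ := rieszConst s * |t| ^ (1 - 2 * s)

/-- The discrete Laplacian, with mesh size one, of the Riesz kernel. -/
noncomputable def dkern (s t : ℝ) : ℝ := -(kern s (t - 1) - 2 * kern s t + kern s (t + 1))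

theorem kern_neg (s t : ℝ) : kern s (-t) = kern s t := by simp [kern]

theorem dkern_neg (s t : ℝ) : dkern s (-t) = dkern s t := by
  unfold dkern
  rw [show -t - 1 = -(t + 1) by ring, show -t + 1 = -(t - 1) by ring]
  simp only [kern_neg]; ring

theorem kern_mul (s : ℝ) {h : ℝ} (hh : 0 < h) (t : ℝ) :
    kern s (h * t) = h ^ (1 - 2 * s) * kern s t := by
  unfold kern
  rw [abs_mul, abs_of_pos hh, Real.mul_rpow hh.le (abs_nonneg _)]; ring

/-- Homogeneity turns the discrete Laplacian of the kernel with mesh size `h` into the one with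
mesh size one. -/
theorem second_diff_kern (s : ℝ) {h : ℝ} (hh : 0 < h) (z : ℝ) :
    -(kern s (z - h) - 2 * kern s z + kern s (z + h)) / h ^ 2
      = h ^ (-1 - 2 * s) * dkern s (z / h) := by
  have e1 : z - h = h * (z / h - 1) := by field_simp
  have e2 : z = h * (z / h) := by field_simp
  have e3 : z + h = h * (z / h + 1) := by field_simp
  have e4 : h ^ (1 - 2 * s) = h ^ (-1 - 2 * s) * h ^ 2 := by
    rw [← Real.rpow_natCast, ← Real.rpow_add hh]; norm_num; congr 1; ring
  have e5 : kern s z = h ^ (1 - 2 * s) * kern s (z / h) := by rw [← kern_mul s hh, ← e2]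
  rw [e1, e3, e5, kern_mul s hh, kern_mul s hh, e4, dkern]
  field_simp

theorem measurable_kern (s : ℝ) : Measurable (kern s) := by
  unfold kern; fun_prop

theorem measurable_dkern (s : ℝ) : Measurable (dkern s) := by
  have := measurable_kern s
  unfold dkern; fun_prop

/-- If a function vanishes at the origin and its derivative is `O(x ^ n)`, then it is
`O(x ^ (n + 1))`. -/
theorem abs_le_pow_succ_of_deriv {F F' : ℝ → ℝ} {b C : ℝ} {n : ℕ}
    (hF : ∀ x ∈ Icc 0 b, HasDerivAt F (F' x) x) (h0 : F 0 = 0)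
    (hF' : ∀ x ∈ Icc 0 b, |F' x| ≤ C * x ^ n) :
    ∀ x ∈ Icc 0 b, |F x| ≤ C * x ^ (n + 1) := by
  intro x hx
  have hC : 0 ≤ C * x ^ n := (abs_nonneg _).trans (hF' x hx)
  rcases hx.1.eq_or_lt with rfl | hx0
  · simp [h0]
  have hC0 : 0 ≤ C := nonneg_of_mul_nonneg_left hC (pow_pos hx0 n)
  have := (convex_Icc 0 x).norm_image_sub_le_of_norm_hasDerivWithin_le (f := F) (f' := F')
    (C := C * x ^ n) (fun y hy => (hF y ⟨hy.1, hy.2.trans hx.2⟩).hasDerivWithinAt)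
    (fun y hy => (hF' y ⟨hy.1, hy.2.trans hx.2⟩).trans
      (mul_le_mul_of_nonneg_left (pow_le_pow_left₀ hy.1 hy.2 n) hC0))
    (left_mem_Icc.2 hx0.le) (right_mem_Icc.2 hx0.le)
  rw [h0, sub_zero, sub_zero, Real.norm_eq_abs, Real.norm_eq_abs, abs_of_pos hx0] at this
  rw [pow_succ, ← mul_assoc]; exact this

theorem hasDerivAt_one_add_rpow (q : ℝ) {x : ℝ} (hx : 1 + x ≠ 0) :
    HasDerivAt (fun x : ℝ => (1 + x) ^ q) (q * (1 + x) ^ (q - 1)) x := by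
  have := ((hasDerivAt_id x).const_add 1).rpow_const (p := q) (Or.inl hx)
  simpa using this

theorem hasDerivAt_one_sub_rpow (q : ℝ) {x : ℝ} (hx : 1 - x ≠ 0) :
    HasDerivAt (fun x : ℝ => (1 - x) ^ q) (-(q * (1 - x) ^ (q - 1))) x := by
  have := ((hasDerivAt_id x).const_sub 1).rpow_const (p := q) (Or.inl hx)
  simpa using this

/-- The even part of the binomial series up to fourth order. -/
theorem exists_second_diff_rpow_bound (q : ℝ) :
    ∃ C, ∀ x ∈ Icc (0 : ℝ) (1 / 2),
      |(1 + x) ^ q + (1 - x) ^ q - 2 - q * (q - 1) * x ^ 2| ≤ C * x ^ 4 := by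
  have hp : ∀ x ∈ Icc (0 : ℝ) (1 / 2), 1 + x ≠ 0 := fun x hx => by linarith [hx.1]
  have hm : ∀ x ∈ Icc (0 : ℝ) (1 / 2), 1 - x ≠ 0 := fun x hx => by linarith [hx.2]
  have hcont : ContinuousOn (fun x : ℝ => q * (q - 1) * (q - 2) * (q - 3) *
      ((1 + x) ^ (q - 4) + (1 - x) ^ (q - 4))) (Icc 0 (1 / 2)) := by
    refine continuousOn_const.mul (ContinuousOn.add ?_ ?_)
    · exact (continuousOn_const.add continuousOn_id).rpow_const fun x hx => Or.inl (hp x hx)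
    · exact (continuousOn_const.sub continuousOn_id).rpow_const fun x hx => Or.inl (hm x hx)
  obtain ⟨C, hC⟩ := isCompact_Icc.exists_bound_of_continuousOn hcont
  refine ⟨C, ?_⟩
  have h3 : ∀ x ∈ Icc (0 : ℝ) (1 / 2),
      |q * (q - 1) * (q - 2) * ((1 + x) ^ (q - 3) - (1 - x) ^ (q - 3))| ≤ C * x ^ 1 := by
    refine abs_le_pow_succ_of_deriv (n := 0) (F' := fun x : ℝ => q * (q - 1) * (q - 2) * (q - 3) *
      ((1 + x) ^ (q - 4) + (1 - x) ^ (q - 4))) (fun x hx => ?_) (by simp)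
      (fun x hx => by rw [pow_zero, mul_one]; exact hC x hx)
    refine (((hasDerivAt_one_add_rpow (q - 3) (hp x hx)).sub
      (hasDerivAt_one_sub_rpow (q - 3) (hm x hx))).const_mul _).congr_deriv ?_
    rw [show q - 3 - 1 = q - 4 by ring]; ring
  have h2 : ∀ x ∈ Icc (0 : ℝ) (1 / 2),
      |q * (q - 1) * ((1 + x) ^ (q - 2) + (1 - x) ^ (q - 2) - 2)| ≤ C * x ^ 2 := by
    refine abs_le_pow_succ_of_deriv (n := 1) (fun x hx => ?_) (by norm_num) h3
    refine ((((hasDerivAt_one_add_rpow (q - 2) (hp x hx)).add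
      (hasDerivAt_one_sub_rpow (q - 2) (hm x hx))).sub_const 2).const_mul _).congr_deriv ?_
    rw [show q - 2 - 1 = q - 3 by ring]; ring
  have h1 : ∀ x ∈ Icc (0 : ℝ) (1 / 2),
      |q * ((1 + x) ^ (q - 1) - (1 - x) ^ (q - 1) - 2 * (q - 1) * x)| ≤ C * x ^ 3 := by
    refine abs_le_pow_succ_of_deriv (n := 2) (fun x hx => ?_) (by simp) h2
    refine ((((hasDerivAt_one_add_rpow (q - 1) (hp x hx)).sub
      (hasDerivAt_one_sub_rpow (q - 1) (hm x hx))).sub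
      ((hasDerivAt_id x).const_mul (2 * (q - 1)))).const_mul _).congr_deriv ?_
    rw [show q - 1 - 1 = q - 2 by ring]; ring
  refine abs_le_pow_succ_of_deriv (n := 3) (fun x hx => ?_) (by norm_num) h1
  refine ((((hasDerivAt_one_add_rpow q (hp x hx)).add
    (hasDerivAt_one_sub_rpow q (hm x hx))).sub_const 2).sub
    ((hasDerivAt_pow 2 x).const_mul (q * (q - 1)))).congr_deriv ?_
  push_cast; ring

/-- Far from the origin the discrete Laplacian of the Riesz kernel agrees with the kernel
`-c_s |t|^{-1-2s}` of the fractional Laplacian up to two further orders. -/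
theorem exists_dkern_add_bound {s : ℝ} (hs1 : s < 1) (hs : s ≠ 1 / 2) :
    ∃ C, ∀ t : ℝ, 2 ≤ |t| →
      |dkern s t + fracConst s * |t| ^ (-1 - 2 * s)| ≤ C * |t| ^ (-3 - 2 * s) := by
  obtain ⟨C, hC⟩ := exists_second_diff_rpow_bound (1 - 2 * s)
  refine ⟨|rieszConst s| * C, ?_⟩
  have key : ∀ t : ℝ, 2 ≤ t →
      |dkern s t + fracConst s * |t| ^ (-1 - 2 * s)| ≤ |rieszConst s| * C * |t| ^ (-3 - 2 * s) := by
    intro t ht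
    have ht0 : 0 < t := by linarith
    have hx : t⁻¹ ∈ Icc (0 : ℝ) (1 / 2) := ⟨by positivity, by
      rw [one_div]; exact inv_anti₀ two_pos ht⟩
    have e1 : |t - 1| = t * (1 - t⁻¹) := by
      rw [abs_of_pos (by linarith)]; field_simp
    have e2 : |t + 1| = t * (1 + t⁻¹) := by
      rw [abs_of_pos (by linarith)]; field_simp
    have e3 : t ^ (-1 - 2 * s) = t ^ (1 - 2 * s) * t⁻¹ ^ 2 := by
      rw [inv_pow, ← Real.rpow_natCast, ← Real.rpow_neg ht0.le, ← Real.rpow_add ht0]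
      congr 1; norm_num; ring
    have e4 : t ^ (-3 - 2 * s) = t ^ (1 - 2 * s) * t⁻¹ ^ 4 := by
      rw [inv_pow, ← Real.rpow_natCast, ← Real.rpow_neg ht0.le, ← Real.rpow_add ht0]
      congr 1; norm_num; ring
    have := hC _ hx
    rw [abs_of_pos ht0, e3, e4, ← rieszConst_mul hs1 hs]
    unfold dkern kern
    rw [e1, e2, abs_of_pos ht0, Real.mul_rpow ht0.le (by linarith [hx.2]),
      Real.mul_rpow ht0.le (by linarith [hx.1])]
    have hp : 0 < t ^ (1 - 2 * s) := Real.rpow_pos_of_pos ht0 _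
    calc _ = |rieszConst s| * (t ^ (1 - 2 * s) * |(1 + t⁻¹) ^ (1 - 2 * s) +
            (1 - t⁻¹) ^ (1 - 2 * s) - 2 - (1 - 2 * s) * (1 - 2 * s - 1) * t⁻¹ ^ 2|) := by
          rw [← abs_of_pos hp, ← abs_mul, ← abs_mul, abs_of_pos hp, ← abs_neg]
          congr 1; ring
      _ ≤ |rieszConst s| * (t ^ (1 - 2 * s) * (C * t⁻¹ ^ 4)) := by gcongr
      _ = _ := by ring
  intro t ht
  rcases le_abs'.1 ht with h | h
  · have := key (-t) (by linarith)
    rwa [dkern_neg, abs_neg] at this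
  · exact key t h

theorem exists_kern_add_one_sub {s : ℝ} (hs0 : 0 < s) (hs1 : s < 1) (hs : s ≠ 1 / 2) {t : ℝ}
    (ht : 0 < t) : ∃ ξ ∈ Ioo t (t + 1),
      kern s (t + 1) - kern s t = -(fracConst s / (2 * s) * ξ ^ (-2 * s)) := by
  obtain ⟨ξ, hξ, h⟩ := exists_hasDerivAt_eq_slope (fun x : ℝ => rieszConst s * x ^ (1 - 2 * s))
    (fun x => rieszConst s * ((1 - 2 * s) * x ^ (1 - 2 * s - 1))) (lt_add_one t)
    (continuousOn_const.mul (continuousOn_id.rpow_const fun x hx => Or.inl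
      (ht.trans_le hx.1).ne'))
    (fun x hx => (Real.hasDerivAt_rpow_const (Or.inl (ht.trans hx.1).ne')).const_mul _)
  refine ⟨ξ, hξ, ?_⟩
  rw [show t + 1 - t = 1 by ring, div_one] at h
  unfold kern
  rw [abs_of_pos ht, abs_of_pos (by linarith), ← h, ← rieszConst_mul hs1 hs,
    show 1 - 2 * s - 1 = -2 * s by ring]
  field_simp
  ring

theorem locallyIntegrable_abs_rpow {r : ℝ} (hr : -1 < r) :
    LocallyIntegrable (fun t : ℝ => |t| ^ r) := by
  refine locallyIntegrable_of_norm_le_rpow (C := 1) (α := -r) (by simp) (by simp; linarith)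
    (ae_of_all _ fun t => ?_)
    (Measurable.aestronglyMeasurable (by fun_prop))
  rw [Real.norm_of_nonneg (Real.rpow_nonneg (abs_nonneg _) _), neg_neg, one_mul, Real.norm_eq_abs]

theorem locallyIntegrable_kern {s : ℝ} (hs1 : s < 1) : LocallyIntegrable (kern s) :=
  (locallyIntegrable_abs_rpow (r := 1 - 2 * s) (by linarith)).smul (rieszConst s)

theorem locallyIntegrable_comp_add_right {f : ℝ → ℝ} (hf : LocallyIntegrable f) (a : ℝ) :
    LocallyIntegrable fun t => f (t + a) := by
  have := locallyIntegrable_map_homeomorph (Homeomorph.addRight a) (f := f) (μ := volume)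
  rw [Homeomorph.coe_addRight, map_add_right_eq_self] at this
  exact this.1 hf

theorem locallyIntegrable_dkern {s : ℝ} (hs1 : s < 1) : LocallyIntegrable (dkern s) := by
  have h := locallyIntegrable_kern hs1
  have h1 := locallyIntegrable_comp_add_right h (-1)
  have h2 := locallyIntegrable_comp_add_right h 1
  have := ((h1.sub (h.smul (2 : ℝ))).add h2).neg
  exact this

/-- A locally integrable even function that decays faster than `1 / |t|` is integrable. -/
theorem integrable_of_even_of_decay {f : ℝ → ℝ} {C r : ℝ} (hf : LocallyIntegrable f)
    (heven : ∀ t, f (-t) = f t) (hr : r < -1) (hC : ∀ t : ℝ, 2 ≤ t → |f t| ≤ C * t ^ r) :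
    Integrable f := by
  refine hf.integrable_of_isBigO_atTop_of_norm_isNegInvariant (g := fun t => t ^ r)
    (ae_of_all _ fun t => by simp [heven]) ?_ (integrableAtFilter_rpow_atTop_iff.2 hr)
  refine Asymptotics.IsBigO.of_bound C ?_
  filter_upwards [eventually_ge_atTop 2] with t ht
  rw [Real.norm_of_nonneg (Real.rpow_nonneg (by linarith : (0 : ℝ) ≤ t) r)]
  exact hC t ht

theorem integrable_dkern {s : ℝ} (hs0 : 0 < s) (hs1 : s < 1) (hs : s ≠ 1 / 2) :
    Integrable (dkern s) := by
  obtain ⟨C, hC⟩ := exists_dkern_add_bound hs1 hs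
  refine integrable_of_even_of_decay (r := -1 - 2 * s) (C := |C| + fracConst s)
    (locallyIntegrable_dkern hs1) (dkern_neg s) (by linarith) fun t ht => ?_
  have ht0 : (0 : ℝ) < t := by linarith
  have h1 := hC t (by rwa [abs_of_pos ht0])
  rw [abs_of_pos ht0] at h1
  have h2 : t ^ (-3 - 2 * s) ≤ t ^ (-1 - 2 * s) :=
    Real.rpow_le_rpow_of_exponent_le (by linarith) (by linarith)
  have h3 : 0 < t ^ (-3 - 2 * s) := Real.rpow_pos_of_pos ht0 _
  have h4 : 0 < t ^ (-1 - 2 * s) := Real.rpow_pos_of_pos ht0 _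
  have h5 := fracConst_pos hs0 hs1
  have h6 : C * t ^ (-3 - 2 * s) ≤ |C| * t ^ (-1 - 2 * s) :=
    mul_le_mul (le_abs_self C) h2 h3.le (abs_nonneg C)
  have h7 : 0 ≤ fracConst s * t ^ (-1 - 2 * s) := by positivity
  rw [abs_le] at h1 ⊢
  constructor <;> linarith

/-- The telescoping structure of the second difference, together with the decay of the first
difference, shows that the discrete Laplacian of the Riesz kernel has mean zero. -/
theorem integral_dkern {s : ℝ} (hs0 : 0 < s) (hs1 : s < 1) (hs : s ≠ 1 / 2) :
    ∫ t, dkern s t = 0 := by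
  have hlim := intervalIntegral_tendsto_integral (integrable_dkern hs0 hs1 hs)
    tendsto_neg_atTop_atBot tendsto_id
  refine tendsto_nhds_unique hlim ?_
  set D : ℝ → ℝ := fun t => kern s (t + 1) - kern s t with hD
  set c := fracConst s / (2 * s) with hc
  have hc0 : 0 < c := by have := fracConst_pos hs0 hs1; positivity
  have hk : ∀ a b, IntervalIntegrable (kern s) volume a b := fun a b =>
    ((locallyIntegrable_kern hs1).integrableOn_isCompact isCompact_uIcc).intervalIntegrable
  have hDi : ∀ a b, IntervalIntegrable D volume a b := fun a b =>
    ((locallyIntegrable_comp_add_right (locallyIntegrable_kern hs1)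
      1).integrableOn_isCompact isCompact_uIcc).intervalIntegrable.sub (hk a b)
  have hDb : ∀ R t : ℝ, 0 < R → R ≤ t → |D t| ≤ c * R ^ (-2 * s) := by
    intro R t hR ht
    obtain ⟨ξ, hξ, h⟩ := exists_kern_add_one_sub hs0 hs1 hs (hR.trans_le ht)
    have h0 : 0 < ξ := hR.trans_le (ht.trans hξ.1.le)
    have : 0 < ξ ^ (-2 * s) := Real.rpow_pos_of_pos h0 _
    rw [hD]
    simp only [h]
    rw [abs_neg, abs_of_pos (by positivity)]
    refine mul_le_mul_of_nonneg_left ?_ hc0.le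
    exact Real.rpow_le_rpow_of_nonpos hR (ht.trans hξ.1.le) (by linarith)
  have hT : ∀ R : ℝ, ∫ t in -R..R, dkern s t
      = (∫ t in (-R - 1)..(-R), D t) - ∫ t in (R - 1)..R, D t := by
    intro R
    rw [← intervalIntegral.integral_interval_sub_interval_comm (hDi _ _) (hDi _ _) (hDi _ _),
      ← intervalIntegral.integral_comp_sub_right D 1, ← intervalIntegral.integral_sub]
    · congr 1; ext t; simp only [hD, dkern]; ring_nf
    · have := (hDi (-R - 1) (R - 1)).comp_sub_right 1
      simpa using this
    · exact hDi _ _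
  have hb : Tendsto (fun R : ℝ => 2 * (c * (R - 1) ^ (-2 * s))) atTop (𝓝 0) := by
    have h1 : Tendsto (fun R : ℝ => (R - 1) ^ (-(2 * s))) atTop (𝓝 0) :=
      (tendsto_rpow_neg_atTop (by linarith : 0 < 2 * s)).comp
        (tendsto_atTop_add_const_right _ (-1) tendsto_id)
    simpa using (h1.const_mul c).const_mul 2
  refine squeeze_zero_norm' ?_ hb
  filter_upwards [eventually_gt_atTop 1] with R hR
  have hR0 : 0 < R - 1 := by linarith
  rw [id, hT R]
  have i1 : ‖∫ t in (-R - 1)..(-R), D t‖ ≤ c * (R - 1) ^ (-2 * s) * |-R - (-R - 1)| := by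
    refine intervalIntegral.norm_integral_le_of_norm_le_const fun t ht => ?_
    rw [uIoc_of_le (by linarith)] at ht
    have : D t = -D (-t - 1) := by
      simp only [hD]
      rw [show -t - 1 = -(t + 1) by ring, kern_neg, show -(t + 1) + 1 = -t by ring, kern_neg]
      ring
    rw [this, norm_neg]
    exact hDb _ _ hR0 (by linarith [ht.2])
  have i2 : ‖∫ t in (R - 1)..R, D t‖ ≤ c * (R - 1) ^ (-2 * s) * |R - (R - 1)| := by
    refine intervalIntegral.norm_integral_le_of_norm_le_const fun t ht => ?_
    rw [uIoc_of_le (by linarith)] at ht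
    exact hDb _ _ hR0 ht.1.le
  have a1 : |-R - (-R - 1)| = 1 := by norm_num
  have a2 : |R - (R - 1)| = 1 := by norm_num
  rw [a1, mul_one] at i1
  rw [a2, mul_one] at i2
  linarith [norm_sub_le (∫ t in (-R - 1)..(-R), D t) (∫ t in (R - 1)..R, D t)]

/-- A bound, uniform in the truncation radius `ε ≤ 1`, for the difference between the kernel
`dkern s` of the discrete operator and the truncated kernel of the fractional Laplacian. -/
noncomputable def kernDefect (s t : ℝ) : ℝ :=
  |dkern s t + fracConst s * |t| ^ (-1 - 2 * s)| +
    (Icc (-1) 1).indicator (fun t => fracConst s * |t| ^ (-1 - 2 * s)) t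

theorem integrable_kernDefect_mul {s α : ℝ} (hs0 : 0 < s) (hs1 : s < 1) (hs : s ≠ 1 / 2)
    (hα0 : 0 < α) (hα : 2 * s - 1 < α) (hα1 : α ≤ 1) :
    Integrable fun t => kernDefect s t * |t| ^ (1 + α) := by
  have hc := fracConst_pos hs0 hs1
  have hcont : Continuous fun t : ℝ => |t| ^ (1 + α) :=
    continuous_abs.rpow_const fun t => Or.inr (by linarith)
  have hprod : ∀ᵐ t : ℝ, |t| ^ (-1 - 2 * s) * |t| ^ (1 + α) = |t| ^ (α - 2 * s) := by
    filter_upwards [compl_mem_ae_iff.2 (measure_singleton (0 : ℝ))] with t ht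
    rw [← Real.rpow_add (abs_pos.2 ht)]; congr 1; ring
  have hloc : LocallyIntegrable fun t : ℝ => fracConst s * |t| ^ (α - 2 * s) :=
    (locallyIntegrable_abs_rpow (by linarith)).smul (fracConst s)
  have hmd := measurable_dkern s
  have h1 : Integrable fun t : ℝ =>
      |dkern s t + fracConst s * |t| ^ (-1 - 2 * s)| * |t| ^ (1 + α) := by
    obtain ⟨C, hC⟩ := exists_dkern_add_bound hs1 hs
    refine integrable_of_even_of_decay (r := -2 - 2 * s + α) (C := C) ?_ (fun t => ?_)
      (by linarith) fun t ht => ?_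
    · have hl : LocallyIntegrable fun t : ℝ =>
          |dkern s t| * |t| ^ (1 + α) + fracConst s * |t| ^ (α - 2 * s) :=
        (((locallyIntegrable_dkern hs1).mono (g := fun t => |dkern s t|) (by fun_prop)
          (ae_of_all _ fun t => by simp)).smul_continuous hcont).add hloc
      refine hl.mono (by fun_prop) ?_
      filter_upwards [hprod] with t ht
      have p1 : 0 ≤ |t| ^ (1 + α) := Real.rpow_nonneg (abs_nonneg _) _
      have p2 : 0 ≤ |t| ^ (-1 - 2 * s) := Real.rpow_nonneg (abs_nonneg _) _
      rw [← ht, ← mul_assoc, ← add_mul, Real.norm_of_nonneg (by positivity),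
        Real.norm_of_nonneg (by positivity)]
      refine mul_le_mul_of_nonneg_right ((abs_add_le _ _).trans ?_) p1
      rw [abs_of_nonneg (mul_nonneg hc.le p2)]
    · simp only [dkern_neg, abs_neg]
    · have ht0 : (0 : ℝ) < t := by linarith
      have := hC t (by rwa [abs_of_pos ht0])
      rw [abs_mul, abs_abs, abs_of_nonneg (Real.rpow_nonneg (abs_nonneg t) _)]
      rw [abs_of_pos ht0] at this ⊢
      calc _ ≤ C * t ^ (-3 - 2 * s) * t ^ (1 + α) :=
            mul_le_mul_of_nonneg_right this (Real.rpow_nonneg ht0.le _)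
        _ = _ := by rw [mul_assoc, ← Real.rpow_add ht0]; congr 2; ring
  have h2 : Integrable ((Icc (-1) 1).indicator fun t : ℝ => fracConst s * |t| ^ (α - 2 * s)) :=
    (integrable_indicator_iff measurableSet_Icc).2 (hloc.integrableOn_isCompact isCompact_Icc)
  refine (h1.add h2).congr ?_
  filter_upwards [hprod] with t ht
  rw [Pi.add_apply, kernDefect, add_mul]
  congr 1
  by_cases h : t ∈ Icc (-1 : ℝ) 1
  · rw [indicator_of_mem h, indicator_of_mem h, ← ht, mul_assoc]
  · rw [indicator_of_notMem h, indicator_of_notMem h, zero_mul]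

/-! ### Weights of the quadrature rule -/

theorem hat_nonneg {h : ℝ} (hh : 0 < h) (y : ℝ) : 0 ≤ hat h y := by
  unfold hat
  split_ifs with hy
  · have : |y| / h ≤ 1 := (div_le_one hh).2 hy.le
    linarith
  · exact le_rfl

theorem hat_neg (h y : ℝ) : hat h (-y) = hat h y := by simp [hat]

theorem hat_eq {h y : ℝ} (hh : 0 < h) (hy : |y| ≤ h) : hat h y = 1 - |y| / h := by
  unfold hat
  split_ifs with h'
  · rfl
  · rw [le_antisymm hy (not_lt.1 h'), div_self hh.ne', sub_self]

theorem hat_eq_max {h : ℝ} (hh : 0 < h) (y : ℝ) : hat h y = max (1 - |y| / h) 0 := by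
  unfold hat
  split_ifs with h'
  · rw [max_eq_left]; have : |y| / h ≤ 1 := (div_le_one hh).2 h'.le; linarith
  · rw [max_eq_right]; have : 1 ≤ |y| / h := (one_le_div hh).2 (not_lt.1 h'); linarith

theorem continuous_hat {h : ℝ} (hh : 0 < h) : Continuous (hat h) := by
  rw [funext (hat_eq_max hh)]
  fun_prop

theorem integral_hat : ∫ y in (-1 : ℝ)..1, hat 1 y = 1 := by
  have hi : ∀ a b, IntervalIntegrable (hat 1) volume a b := fun a b =>
    (continuous_hat one_pos).intervalIntegrable a b
  have h1 : ∫ y in (0 : ℝ)..1, hat 1 y = 1 / 2 := by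
    rw [intervalIntegral.integral_congr (g := fun y => 1 - y)]
    · rw [intervalIntegral.integral_sub (by simp) (by simp)]; norm_num
    · intro y hy
      rw [uIcc_of_le zero_le_one] at hy
      simp only
      rw [hat_eq one_pos (by rw [abs_of_nonneg hy.1]; exact hy.2), abs_of_nonneg hy.1, div_one]
  have h2 : ∫ y in (-1 : ℝ)..0, hat 1 y = 1 / 2 := by
    rw [← h1]
    have := intervalIntegral.integral_comp_neg (a := 0) (b := 1) (hat 1)
    simp only [hat_neg, neg_zero] at this
    exact this.symm
  rw [← intervalIntegral.integral_add_adjacent_intervals (hi (-1) 0) (hi 0 1), h1, h2]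
  norm_num

theorem omegaBar_eq (s h : ℝ) (k : ℤ) :
    omegaBar s h k = ∫ y in (-h)..h, kern s (k * h - y) * hat h y := by
  unfold omegaBar kern
  rw [← intervalIntegral.integral_const_mul]
  congr 1; ext y; ring

theorem omegaBar_neg (s h : ℝ) (k : ℤ) : omegaBar s h (-k) = omegaBar s h k := by
  have := intervalIntegral.integral_comp_neg (a := -h) (b := h)
    (fun y => kern s (k * h - y) * hat h y)
  rw [neg_neg] at this
  rw [omegaBar_eq, omegaBar_eq, ← this]
  refine intervalIntegral.integral_congr fun y _ => ?_
  simp only [hat_neg]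
  rw [← kern_neg]
  push_cast
  congr 2
  ring

theorem omegaBar_scale (s : ℝ) {h : ℝ} (hh : 0 < h) (k : ℤ) :
    omegaBar s h k = h ^ (2 - 2 * s) * omegaBar s 1 k := by
  rw [omegaBar_eq, omegaBar_eq]
  have := intervalIntegral.mul_integral_comp_mul_left (a := -1) (b := 1)
    (f := fun y => kern s (k * h - y) * hat h y) h
  rw [mul_neg_one, mul_one] at this
  rw [← this, ← intervalIntegral.integral_const_mul, ← intervalIntegral.integral_const_mul]
  refine intervalIntegral.integral_congr fun y _ => ?_
  have e1 : hat h (h * y) = hat 1 y := by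
    unfold hat
    rw [abs_mul, abs_of_pos hh, mul_div_cancel_left₀ _ hh.ne', div_one]
    simp only [mul_lt_iff_lt_one_right hh]
  have e2 : (k : ℝ) * h - h * y = h * (k * 1 - y) := by ring
  simp only [e1]
  rw [e2, kern_mul s hh, show (2 : ℝ) - 2 * s = 1 + (1 - 2 * s) by ring, Real.rpow_add hh,
    Real.rpow_one]
  ring

theorem weight_scale (s : ℝ) {h : ℝ} (hh : 0 < h) (k : ℤ) :
    weight s h k = h ^ (-(2 * s)) * weight s 1 k := by
  unfold weight discNegLaplacian
  rw [omegaBar_scale s hh, omegaBar_scale s hh k, omegaBar_scale s hh (k + 1),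
    show (2 : ℝ) - 2 * s = 2 + -(2 * s) by ring, Real.rpow_add hh, Real.rpow_two]
  field_simp

theorem omegaBarM_scale (s : ℝ) {h : ℝ} (hh : 0 < h) (k : ℤ) :
    omegaBarM s h k = h ^ (2 - 2 * s) * omegaBarM s 1 k := by
  have : 0 ≤ weight s h 1 ↔ 0 ≤ weight s 1 1 := by
    rw [weight_scale s hh, mul_nonneg_iff_of_pos_left (Real.rpow_pos_of_pos hh _)]
  unfold omegaBarM
  simp only [this]
  split_ifs
  · simp
  · exact omegaBar_scale s hh k

theorem omegaBarM_neg (s h : ℝ) (k : ℤ) : omegaBarM s h (-k) = omegaBarM s h k := by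
  simp [omegaBarM, omegaBar_neg]

theorem weightM_neg (s h : ℝ) (k : ℤ) : weightM s h (-k) = weightM s h k := by
  unfold weightM discNegLaplacian
  rw [show -k - 1 = -(k + 1) by ring, show -k + 1 = -(k - 1) by ring]
  simp only [omegaBarM_neg]
  ring

theorem weightM_abs (s h : ℝ) (k : ℤ) : weightM s h |k| = weightM s h k := by
  rcases abs_choice k with h' | h' <;> rw [h']
  exact weightM_neg s h k

theorem dkern_nonpos {s : ℝ} (hs0 : 0 < s) (hs1 : s < 1) (hs : s ≠ 1 / 2) {t : ℝ} (ht : 1 < t) :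
    dkern s t ≤ 0 := by
  obtain ⟨ξ, hξ, h1⟩ := exists_kern_add_one_sub hs0 hs1 hs (show 0 < t by linarith)
  obtain ⟨η, hη, h2⟩ := exists_kern_add_one_sub hs0 hs1 hs (show 0 < t - 1 by linarith)
  rw [sub_add_cancel] at h2 hη
  have h3 : ξ ^ (-2 * s) ≤ η ^ (-2 * s) := Real.rpow_le_rpow_of_nonpos
    (by linarith [hη.1]) (by linarith [hη.2, hξ.1]) (by linarith)
  have := mul_le_mul_of_nonneg_left h3
    (show 0 ≤ fracConst s / (2 * s) by have := fracConst_pos hs0 hs1; positivity)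
  unfold dkern
  linarith

theorem intervalIntegrable_kern_mul_hat {s : ℝ} (hs1 : s < 1) (c a b : ℝ) :
    IntervalIntegrable (fun y => kern s (c - y) * hat 1 y) volume a b := by
  have h1 : IntervalIntegrable (kern s) volume (c - a) (c - b) :=
    ((locallyIntegrable_kern hs1).integrableOn_isCompact isCompact_uIcc).intervalIntegrable
  have h2 := h1.comp_sub_left c
  rw [sub_sub_cancel, sub_sub_cancel] at h2
  exact h2.mul_continuousOn (continuous_hat one_pos).continuousOn

theorem weight_nonpos {s : ℝ} (hs0 : 0 < s) (hs1 : s < 1) (hs : s ≠ 1 / 2) {k : ℤ} (hk : 2 ≤ k) :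
    weight s 1 k ≤ 0 := by
  have hi := intervalIntegrable_kern_mul_hat hs1
  have hkr : (2 : ℝ) ≤ k := by exact_mod_cast hk
  have : weight s 1 k = ∫ y in (-1 : ℝ)..1, dkern s (k - y) * hat 1 y := by
    unfold weight discNegLaplacian
    rw [omegaBar_eq, omegaBar_eq, omegaBar_eq, one_pow, div_one,
      ← intervalIntegral.integral_const_mul, ← intervalIntegral.integral_sub (hi _ _ _)
      ((hi _ _ _).const_mul _), ← intervalIntegral.integral_add ((hi _ _ _).sub
      ((hi _ _ _).const_mul _)) (hi _ _ _), ← intervalIntegral.integral_neg]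
    refine intervalIntegral.integral_congr fun y _ => ?_
    simp only [dkern]
    push_cast
    rw [show ((k : ℝ) - 1) * 1 - y = k - y - 1 by ring,
      show ((k : ℝ) + 1) * 1 - y = k - y + 1 by ring, mul_one]
    ring
  rw [this, ← neg_nonneg, ← intervalIntegral.integral_neg]
  refine intervalIntegral.integral_nonneg (by norm_num) fun y hy => ?_
  rcases hy.2.eq_or_lt with rfl | hy1
  · simp [hat]
  · rw [neg_nonneg]
    exact mul_nonpos_of_nonpos_of_nonneg (dkern_nonpos hs0 hs1 hs (by linarith))
      (hat_nonneg one_pos y)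

theorem omegaBar_succ_sub_le {s : ℝ} (hs0 : 0 < s) (hs1 : s < 1) (hs : s ≠ 1 / 2) {k : ℤ}
    (hk : 1 ≤ k) : omegaBar s 1 (k + 1) - omegaBar s 1 k
      ≤ -(fracConst s / (2 * s) * ((k : ℝ) + 2) ^ (-2 * s)) := by
  have hi := intervalIntegrable_kern_mul_hat hs1
  have hkr : (1 : ℝ) ≤ k := by exact_mod_cast hk
  have hc : 0 ≤ fracConst s / (2 * s) := by have := fracConst_pos hs0 hs1; positivity
  rw [omegaBar_eq, omegaBar_eq, ← intervalIntegral.integral_sub (hi _ _ _) (hi _ _ _)]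
  have hmass : ∫ y in (-1 : ℝ)..1, -(fracConst s / (2 * s) * ((k : ℝ) + 2) ^ (-2 * s)) * hat 1 y
      = -(fracConst s / (2 * s) * ((k : ℝ) + 2) ^ (-2 * s)) := by
    rw [intervalIntegral.integral_const_mul, integral_hat, mul_one]
  rw [← hmass]
  refine intervalIntegral.integral_mono_on (by norm_num) ((hi _ _ _).sub (hi _ _ _))
    (((continuous_hat one_pos).intervalIntegrable _ _).const_mul _) fun y hy => ?_
  rcases hy.2.eq_or_lt with rfl | hy1
  · simp [hat]
  · rw [← sub_mul]
    refine mul_le_mul_of_nonneg_right ?_ (hat_nonneg one_pos y)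
    obtain ⟨ξ, hξ, h⟩ := exists_kern_add_one_sub hs0 hs1 hs (show 0 < (k : ℝ) - y by linarith)
    push_cast
    rw [show ((k : ℝ) + 1) * 1 - y = k - y + 1 by ring, mul_one, h, neg_le_neg_iff]
    refine mul_le_mul_of_nonneg_left ?_ hc
    exact Real.rpow_le_rpow_of_nonpos (by linarith [hξ.1]) (by linarith [hξ.2, hy.1])
      (by linarith)

theorem integral_rpow_mul_affine {q a b c m : ℝ} (hq : -1 < q) (ha : 0 ≤ a) (hab : a ≤ b) :
    ∫ x in a..b, x ^ q * (c + m * x)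
      = c * ((b ^ (q + 1) - a ^ (q + 1)) / (q + 1))
        + m * ((b ^ (q + 2) - a ^ (q + 2)) / (q + 2)) := by
  rw [intervalIntegral.integral_congr (g := fun x => c * x ^ q + m * x ^ (q + 1))]
  · rw [intervalIntegral.integral_add
      ((intervalIntegral.intervalIntegrable_rpow' hq).const_mul c)
      ((intervalIntegral.intervalIntegrable_rpow' (by linarith)).const_mul m),
      intervalIntegral.integral_const_mul, intervalIntegral.integral_const_mul,
      integral_rpow (Or.inl hq), integral_rpow (Or.inl (by linarith)),
      show q + 1 + 1 = q + 2 by ring]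
  · intro x hx
    rw [uIcc_of_le hab] at hx
    simp only
    rw [Real.rpow_add_one' (ha.trans hx.1) (by linarith)]
    ring

/-- Averaging `|x| ^ q` against the hat function is taking a second difference of its second
antiderivative `|x| ^ (q + 2) / ((q + 1) (q + 2))`. -/
theorem integral_rpow_mul_hat {q : ℝ} (hq : -1 < q) {k : ℝ} (hk : 1 ≤ k) :
    ∫ y in (-1 : ℝ)..1, |k - y| ^ q * hat 1 y
      = ((k + 1) ^ (q + 2) - 2 * k ^ (q + 2) + (k - 1) ^ (q + 2)) / ((q + 1) * (q + 2)) := by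
  have hi : ∀ a b, IntervalIntegrable (fun x => |x| ^ q * hat 1 (k - x)) volume a b := by
    intro a b
    refine IntervalIntegrable.mul_continuousOn ?_
      ((continuous_hat one_pos).comp (continuous_const.sub continuous_id)).continuousOn
    exact ((locallyIntegrable_abs_rpow hq).integrableOn_isCompact
      isCompact_uIcc).intervalIntegrable
  have h0 := intervalIntegral.integral_comp_sub_left (a := -1) (b := 1)
    (fun x => |x| ^ q * hat 1 (k - x)) k
  simp only [sub_sub_cancel, sub_neg_eq_add] at h0
  have h1 : ∫ x in (k - 1)..k, |x| ^ q * hat 1 (k - x)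
      = ∫ x in (k - 1)..k, x ^ q * ((1 - k) + 1 * x) := by
    refine intervalIntegral.integral_congr fun x hx => ?_
    rw [uIcc_of_le (by linarith)] at hx
    have : |k - x| = k - x := abs_of_nonneg (by linarith [hx.2])
    rw [hat_eq one_pos (by rw [this]; linarith [hx.1]), this,
      abs_of_nonneg (by linarith [hx.1] : 0 ≤ x)]
    ring
  have h2 : ∫ x in k..(k + 1), |x| ^ q * hat 1 (k - x)
      = ∫ x in k..(k + 1), x ^ q * ((1 + k) + (-1) * x) := by
    refine intervalIntegral.integral_congr fun x hx => ?_
    rw [uIcc_of_le (by linarith)] at hx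
    have : |k - x| = x - k := by rw [abs_sub_comm]; exact abs_of_nonneg (by linarith [hx.1])
    rw [hat_eq one_pos (by rw [this]; linarith [hx.2]), this,
      abs_of_nonneg (by linarith [hx.1] : 0 ≤ x)]
    ring
  have p : ∀ x : ℝ, 0 ≤ x → x ^ (q + 2) = x ^ (q + 1) * x := fun x hx => by
    rw [← Real.rpow_add_one' hx (by linarith)]; congr 1; ring
  have hq1 : q + 1 ≠ 0 := by linarith
  have hq2 : q + 2 ≠ 0 := by linarith
  rw [h0, ← intervalIntegral.integral_add_adjacent_intervals (hi (k - 1) k) (hi k (k + 1)), h1, h2,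
    integral_rpow_mul_affine hq (by linarith) (by linarith),
    integral_rpow_mul_affine hq (by linarith) (by linarith), p k (by linarith),
    p (k - 1) (by linarith), p (k + 1) (by linarith)]
  field_simp
  ring

theorem integral_rpow_mul_hat_zero {q : ℝ} (hq : -1 < q) :
    ∫ y in (-1 : ℝ)..1, |y| ^ q * hat 1 y = 2 / ((q + 1) * (q + 2)) := by
  have hi : ∀ a b, IntervalIntegrable (fun x => |x| ^ q * hat 1 x) volume a b := by
    intro a b
    refine IntervalIntegrable.mul_continuousOn ?_ (continuous_hat one_pos).continuousOn
    exact ((locallyIntegrable_abs_rpow hq).integrableOn_isCompact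
      isCompact_uIcc).intervalIntegrable
  have h1 : ∫ x in (0 : ℝ)..1, |x| ^ q * hat 1 x = ∫ x in (0 : ℝ)..1, x ^ q * (1 + (-1) * x) := by
    refine intervalIntegral.integral_congr fun x hx => ?_
    rw [uIcc_of_le (by norm_num)] at hx
    have : |x| = x := abs_of_nonneg hx.1
    rw [hat_eq one_pos (by rw [this]; exact hx.2), this]
    ring
  have h2 : ∫ x in (-1 : ℝ)..0, |x| ^ q * hat 1 x = ∫ x in (0 : ℝ)..1, |x| ^ q * hat 1 x := by
    have := intervalIntegral.integral_comp_neg (a := 0) (b := 1) (fun x => |x| ^ q * hat 1 x)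
    simp only [hat_neg, abs_neg, neg_zero] at this
    exact this.symm
  have hq1 : q + 1 ≠ 0 := by linarith
  have hq2 : q + 2 ≠ 0 := by linarith
  rw [← intervalIntegral.integral_add_adjacent_intervals (hi (-1) 0) (hi 0 1), h2, h1,
    integral_rpow_mul_affine hq le_rfl zero_le_one, Real.one_rpow, Real.one_rpow,
    Real.zero_rpow hq1, Real.zero_rpow hq2]
  field_simp
  ring

/-- For exponents `0 < p < 2` this says that the fourth difference of `|x| ^ p` at `1` is
positive. After division by `2 ^ p` it is convex in `p` and vanishes, with negative slope, at `p = 2`. -/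
theorem three_rpow_sub_pos {p : ℝ} (hp : p < 2) : 0 < (3 : ℝ) ^ p - 4 * 2 ^ p + 7 := by
  have h1 : 9 / 4 * (1 + (p - 2) * Real.log (3 / 2)) ≤ (3 / 2 : ℝ) ^ p := by
    have := Real.add_one_le_exp (Real.log (3 / 2) * (p - 2))
    rw [← Real.rpow_def_of_pos (by norm_num), Real.rpow_sub (by norm_num), Real.rpow_two] at this
    norm_num at this ⊢
    linarith
  have h2 : 1 / 4 * (1 - (p - 2) * Real.log 2) ≤ (1 / 2 : ℝ) ^ p := by
    have := Real.add_one_le_exp (Real.log (1 / 2) * (p - 2))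
    rw [← Real.rpow_def_of_pos (by norm_num), Real.rpow_sub (by norm_num), Real.rpow_two,
      one_div, Real.log_inv] at this
    norm_num at this ⊢
    linarith
  have h3 : 9 * Real.log (3 / 2) < 7 * Real.log 2 := by
    have : Real.log ((3 / 2) ^ 9) < Real.log (2 ^ 7) := Real.log_lt_log (by norm_num) (by norm_num)
    rw [Real.log_pow, Real.log_pow] at this
    exact_mod_cast this
  have h4 : 0 < (2 : ℝ) ^ p := Real.rpow_pos_of_pos two_pos _
  have e1 : (3 : ℝ) ^ p = 2 ^ p * (3 / 2) ^ p := by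
    rw [← Real.mul_rpow (by norm_num) (by norm_num)]; norm_num
  have e2 : (2 : ℝ) ^ p * (1 / 2) ^ p = 1 := by
    rw [← Real.mul_rpow (by norm_num) (by norm_num)]; norm_num
  have h5 : 0 < (3 / 2 : ℝ) ^ p - 4 + 7 * (1 / 2) ^ p := by
    nlinarith [mul_pos (sub_pos.2 hp) (sub_pos.2 h3)]
  have := mul_pos h4 h5
  rw [e1]
  linarith [this, e2]

/-- After division by `2 ^ p` the right-hand side minus the left-hand side is concave in `p`; it
is nonnegative at `p = 2` and `p = 3`. -/
theorem three_rpow_add_le {p : ℝ} (hp2 : 2 ≤ p) (hp3 : p ≤ 3) : (3 : ℝ) ^ p + 5 ≤ 4 * 2 ^ p := by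
  have key : ∀ a : ℝ, 0 < a → a ^ p ≤ (3 - p) * a ^ 2 + (p - 2) * a ^ 3 := by
    intro a ha
    have := Real.geom_mean_le_arith_mean2_weighted (w₁ := 3 - p) (w₂ := p - 2) (p₁ := a ^ 2)
      (p₂ := a ^ 3) (by linarith) (by linarith) (by positivity) (by positivity) (by ring)
    rw [← Real.rpow_natCast a 2, ← Real.rpow_natCast a 3, ← Real.rpow_mul ha.le,
      ← Real.rpow_mul ha.le, ← Real.rpow_add ha] at this
    convert this using 2
    · push_cast; ring
    · rw [← Real.rpow_natCast]
    · rw [← Real.rpow_natCast]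
  have h1 := key (3 / 2) (by norm_num)
  have h2 := key (1 / 2) (by norm_num)
  have h4 : 0 < (2 : ℝ) ^ p := Real.rpow_pos_of_pos two_pos _
  have e1 : (3 : ℝ) ^ p = 2 ^ p * (3 / 2) ^ p := by
    rw [← Real.mul_rpow (by norm_num) (by norm_num)]; norm_num
  have e2 : (2 : ℝ) ^ p * (1 / 2) ^ p = 1 := by
    rw [← Real.mul_rpow (by norm_num) (by norm_num)]; norm_num
  have h5 : 0 ≤ 4 - (3 / 2 : ℝ) ^ p - 5 * (1 / 2) ^ p := by
    norm_num at h1 h2 ⊢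
    linarith
  have := mul_nonneg h4.le h5
  rw [e1]
  linarith [this, e2]

/-- The modification of the central weight makes all off-diagonal weights nonpositive: for
`s > 1/2` the weight `w_1` is negative and nothing is modified, while for `s < 1/2` the weight
`w_1` becomes `2 ω̄_1 - ω̄_2 ≤ 0` whenever it is modified. -/
theorem weightM_nonpos {s : ℝ} (hs0 : 0 < s) (hs1 : s < 1) (hs : s ≠ 1 / 2) {k : ℤ} (hk : 1 ≤ k) :
    weightM s 1 k ≤ 0 := by
  rcases hk.eq_or_lt with rfl | hk
  swap
  · have : weightM s 1 k = weight s 1 k := by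
      unfold weightM weight discNegLaplacian omegaBarM
      rw [if_neg (by omega), if_neg (by omega), if_neg (by omega)]
    rw [this]
    exact weight_nonpos hs0 hs1 hs (by omega)
  by_cases hw : 0 ≤ weight s 1 1
  · have hq : -1 < 1 - 2 * s := by linarith
    have hr := rieszConst_mul hs1 hs
    have hc := fracConst_pos hs0 hs1
    have o0 : omegaBar s 1 0 = rieszConst s * (2 / ((2 - 2 * s) * (3 - 2 * s))) := by
      unfold omegaBar
      have := integral_rpow_mul_hat_zero hq
      rw [show 1 - 2 * s + 1 = 2 - 2 * s by ring, show 1 - 2 * s + 2 = 3 - 2 * s by ring] at this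
      rw [← this]; simp
    have o1 : omegaBar s 1 1
        = rieszConst s * ((2 ^ (3 - 2 * s) - 2) / ((2 - 2 * s) * (3 - 2 * s))) := by
      unfold omegaBar
      have := integral_rpow_mul_hat hq le_rfl
      rw [show 1 - 2 * s + 1 = 2 - 2 * s by ring, show 1 - 2 * s + 2 = 3 - 2 * s by ring,
        sub_self, Real.zero_rpow (by linarith), Real.one_rpow, one_add_one_eq_two, mul_one,
        add_zero] at this
      rw [← this]; simp
    have o2 : omegaBar s 1 2 = rieszConst s *
        ((3 ^ (3 - 2 * s) - 2 * 2 ^ (3 - 2 * s) + 1) / ((2 - 2 * s) * (3 - 2 * s))) := by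
      unfold omegaBar
      have := integral_rpow_mul_hat hq one_le_two
      rw [show 1 - 2 * s + 1 = 2 - 2 * s by ring, show 1 - 2 * s + 2 = 3 - 2 * s by ring,
        show (2 : ℝ) - 1 = 1 by norm_num, Real.one_rpow, show (2 : ℝ) + 1 = 3 by norm_num] at this
      rw [← this]; simp
    have hden : 0 < (2 - 2 * s) * (3 - 2 * s) := mul_pos (by linarith) (by linarith)
    rcases lt_or_gt_of_ne hs with hs2 | hs2
    · -- here `κ < 0`
      have hk : rieszConst s < 0 := by
        have : 2 * s * (2 * s - 1) < 0 := mul_neg_of_pos_of_neg (by linarith) (by linarith)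
        by_contra hcon
        nlinarith [mul_nonneg (not_lt.1 hcon) (neg_pos.2 this).le]
      have : weightM s 1 1 = rieszConst s *
          ((4 * 2 ^ (3 - 2 * s) - 3 ^ (3 - 2 * s) - 5) / ((2 - 2 * s) * (3 - 2 * s))) := by
        unfold weightM discNegLaplacian omegaBarM
        norm_num [hw]
        rw [o1, o2]
        ring
      rw [this]
      exact mul_nonpos_of_nonpos_of_nonneg hk.le (div_nonneg
        (by linarith [three_rpow_add_le (p := 3 - 2 * s) (by linarith) (by linarith)]) hden.le)
    · -- here `κ > 0`, so that `w_1 < 0`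
      have hk : 0 < rieszConst s := by
        have : 0 < 2 * s * (2 * s - 1) := mul_pos (by linarith) (by linarith)
        by_contra hcon
        nlinarith [mul_nonneg (neg_nonneg.2 (not_lt.1 hcon)) this.le]
      exfalso
      have : weight s 1 1 = -(rieszConst s *
          ((3 ^ (3 - 2 * s) - 4 * 2 ^ (3 - 2 * s) + 7) / ((2 - 2 * s) * (3 - 2 * s)))) := by
        unfold weight discNegLaplacian
        norm_num
        rw [o0, o1, o2]
        ring
      have h2 := mul_pos hk (div_pos (three_rpow_sub_pos (p := 3 - 2 * s) (by linarith)) hden)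
      linarith
  · have : weightM s 1 1 = weight s 1 1 := by
      unfold weightM weight
      congr 1
      ext k
      rw [omegaBarM, if_neg (fun h => hw h.2)]
    rw [this]
    exact (not_le.1 hw).le

/-! ### Stability of the scheme -/

/-- The discrete maximum principle in quantitative form: nonpositive off-diagonal entries and row
sums bounded below by `r` give an inverse bounded by `1 / r` in the supremum norm. -/
theorem norm_le_norm_mulVec {ι : Type*} [Fintype ι] {A : Matrix ι ι ℝ} {r : ℝ}
    (hA : ∀ i j, i ≠ j → A i j ≤ 0) (hr : ∀ i, r ≤ ∑ j, A i j) (v : ι → ℝ) :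
    r * ‖v‖ ≤ ‖A.mulVec v‖ := by
  rcases isEmpty_or_nonempty ι with hι | hι
  · simp [Subsingleton.elim v 0]
  obtain ⟨i, hi⟩ := Finite.exists_max fun i => |v i|
  have hv : ‖v‖ = |v i| := le_antisymm
    ((pi_norm_le_iff_of_nonneg (abs_nonneg _)).2 hi) (norm_le_pi_norm v i)
  have key : ∀ w : ι → ℝ, (∀ j, |w j| ≤ w i) → r * w i ≤ A.mulVec w i := by
    intro w hw
    have hwi : 0 ≤ w i := (abs_nonneg _).trans (hw i)
    calc r * w i ≤ (∑ j, A i j) * w i := mul_le_mul_of_nonneg_right (hr i) hwi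
      _ = ∑ j, A i j * w i := Finset.sum_mul _ _ _
      _ ≤ ∑ j, A i j * w j := by
        refine Finset.sum_le_sum fun j _ => ?_
        rcases eq_or_ne i j with rfl | hij
        · exact le_rfl
        · exact mul_le_mul_of_nonpos_left ((le_abs_self _).trans (hw j)) (hA i j hij)
  rw [hv]
  refine le_trans ?_ (norm_le_pi_norm (A.mulVec v) i)
  rcases abs_cases (v i) with ⟨h, -⟩ | ⟨h, -⟩
  · rw [h]
    exact (key v fun j => h ▸ hi j).trans (le_abs_self _)
  · rw [h]
    refine (key (-v) fun j => ?_).trans ?_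
    · simpa only [Pi.neg_apply, abs_neg, ← h] using hi j
    · rw [Matrix.mulVec_neg]; exact neg_le_abs _

theorem weightM_scale (s : ℝ) {h : ℝ} (hh : 0 < h) (k : ℤ) :
    weightM s h k = h ^ (-(2 * s)) * weightM s 1 k := by
  unfold weightM discNegLaplacian
  rw [omegaBarM_scale s hh, omegaBarM_scale s hh k, omegaBarM_scale s hh (k + 1),
    show (2 : ℝ) - 2 * s = 2 + -(2 * s) by ring, Real.rpow_add hh, Real.rpow_two]
  field_simp

theorem sum_discNegLaplacian_one (v : ℤ → ℝ) (i : ℤ) (n : ℕ) :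
    ∑ j ∈ Finset.range n, discNegLaplacian 1 v (i - j)
      = -((v (i + 1) - v i) - (v (i - n + 1) - v (i - n))) := by
  induction n with
  | zero => simp
  | succ n ih =>
    rw [Finset.sum_range_succ, ih]
    unfold discNegLaplacian
    push_cast
    rw [show i - ((n : ℤ) + 1) + 1 = i - n by ring, show i - ((n : ℤ) + 1) = i - n - 1 by ring]
    ring

/-- Off-diagonal weights are nonpositive, so the first differences of `ω̄^M` increase; far out they
are bounded by the derivative of the Riesz kernel. -/
theorem omegaBarM_succ_sub_le {s : ℝ} (hs0 : 0 < s) (hs1 : s < 1) (hs : s ≠ 1 / 2) {N : ℕ}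
    (hN : 1 ≤ N) {k : ℕ} (hk : k ≤ N) : omegaBarM s 1 (k + 1) - omegaBarM s 1 k
      ≤ -(fracConst s / (2 * s) * ((N : ℝ) + 2) ^ (-2 * s)) := by
  induction hk using Nat.decreasingInduction with
  | self =>
    unfold omegaBarM
    rw [if_neg (by omega), if_neg (by omega)]
    have := omegaBar_succ_sub_le hs0 hs1 hs (k := N) (by omega)
    exact_mod_cast this
  | of_succ k hk ih =>
    refine le_trans ?_ ih
    have := weightM_nonpos hs0 hs1 hs (k := k + 1) (by omega)
    unfold weightM discNegLaplacian at this
    rw [add_sub_cancel_right] at this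
    push_cast
    linarith

theorem meshSize_pos {L : ℝ} (hL : 0 < L) {N : ℕ} (hN : 0 < N) : 0 < meshSize L N := by
  unfold meshSize; positivity

theorem schemeMatrix_apply (s L : ℝ) (N : ℕ) (i j : Fin (N - 1)) :
    schemeMatrix s L N i j = weightM s (meshSize L N) ((i : ℤ) - (j : ℤ)) := by
  rw [schemeMatrix, Matrix.of_apply, weightM_abs]

theorem le_sum_schemeMatrix {s L : ℝ} (hs0 : 0 < s) (hs1 : s < 1) (hs : s ≠ 1 / 2) (hL : 0 < L)
    {N : ℕ} (hN : 0 < N) (i : Fin (N - 1)) :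
    fracConst s / s * (6 * L) ^ (-(2 * s)) ≤ ∑ j, schemeMatrix s L N i j := by
  have hh := meshSize_pos hL hN
  have hNr : (1 : ℝ) ≤ N := by exact_mod_cast hN
  have hi := i.2
  have h1 : ∑ j, schemeMatrix s L N i j = meshSize L N ^ (-(2 * s)) *
      ∑ j ∈ Finset.range (N - 1), weightM s 1 ((i : ℤ) - j) := by
    rw [Finset.mul_sum, ← Fin.sum_univ_eq_sum_range
      (fun j : ℕ => meshSize L N ^ (-(2 * s)) * weightM s 1 ((i : ℤ) - j))]
    refine Finset.sum_congr rfl fun j _ => ?_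
    rw [schemeMatrix_apply, weightM_scale s hh]
  have h2 : ∑ j ∈ Finset.range (N - 1), weightM s 1 ((i : ℤ) - j)
      = -((omegaBarM s 1 ((i : ℕ) + 1) - omegaBarM s 1 (i : ℕ)) +
        (omegaBarM s 1 ((N - 1 - 1 - i : ℕ) + 1) - omegaBarM s 1 (N - 1 - 1 - i : ℕ))) := by
    refine (sum_discNegLaplacian_one _ _ _).trans ?_
    rw [show (i : ℤ) - ((N - 1 : ℕ) : ℤ) + 1 = -((N - 1 - 1 - i : ℕ) : ℤ) by omega,
      show (i : ℤ) - ((N - 1 : ℕ) : ℤ) = -(((N - 1 - 1 - i : ℕ) : ℤ) + 1) by omega,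
      omegaBarM_neg, omegaBarM_neg]
    ring
  have h3 := omegaBarM_succ_sub_le hs0 hs1 hs (N := N) (by omega) (k := i) (by omega)
  have h4 := omegaBarM_succ_sub_le hs0 hs1 hs (N := N) (by omega) (k := N - 1 - 1 - i) (by omega)
  rw [h1, h2]
  have h5 : (6 * L) ^ (-(2 * s)) ≤ meshSize L N ^ (-(2 * s)) * ((N : ℝ) + 2) ^ (-2 * s) := by
    rw [neg_mul, ← Real.mul_rpow hh.le (by linarith)]
    refine Real.rpow_le_rpow_of_nonpos (by positivity) ?_ (by linarith)
    unfold meshSize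
    rw [div_mul_eq_mul_div, div_le_iff₀ (by linarith)]
    nlinarith
  have h6 : 0 < meshSize L N ^ (-(2 * s)) := Real.rpow_pos_of_pos hh _
  have h7 := fracConst_pos hs0 hs1
  calc fracConst s / s * (6 * L) ^ (-(2 * s))
      ≤ fracConst s / s * (meshSize L N ^ (-(2 * s)) * ((N : ℝ) + 2) ^ (-2 * s)) :=
        mul_le_mul_of_nonneg_left h5 (by positivity)
    _ = meshSize L N ^ (-(2 * s)) *
        (2 * (fracConst s / (2 * s) * ((N : ℝ) + 2) ^ (-2 * s))) := by field_simp
    _ ≤ _ := mul_le_mul_of_nonneg_left (by linarith) h6.le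

/-- Stability of the scheme in the supremum norm, uniformly in the mesh size. -/
theorem exists_stability {s L : ℝ} (hs0 : 0 < s) (hs1 : s < 1) (hs : s ≠ 1 / 2) (hL : 0 < L) :
    ∃ r > 0, ∀ N : ℕ, 0 < N → ∀ v : Fin (N - 1) → ℝ,
      r * ‖v‖ ≤ ‖(schemeMatrix s L N).mulVec v‖ := by
  have hc := fracConst_pos hs0 hs1
  refine ⟨fracConst s / s * (6 * L) ^ (-(2 * s)), by positivity, fun N hN v => ?_⟩
  refine norm_le_norm_mulVec (fun i j hij => ?_) (le_sum_schemeMatrix hs0 hs1 hs hL hN) v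
  have hij' : (i : ℕ) ≠ j := fun h => hij (Fin.ext h)
  rw [schemeMatrix, Matrix.of_apply, weightM_scale s (meshSize_pos hL hN)]
  exact mul_nonpos_of_nonneg_of_nonpos (Real.rpow_nonneg (meshSize_pos hL hN).le _)
    (weightM_nonpos hs0 hs1 hs (Int.one_le_abs (by omega)))

theorem existsUnique_of_stability {m : ℕ} {A : Matrix (Fin m) (Fin m) ℝ} {r : ℝ} (hr : 0 < r)
    (hA : ∀ v, r * ‖v‖ ≤ ‖A.mulVec v‖) (b c : Fin m → ℝ) : ∃! v, A.mulVec v + b = c := by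
  have hinj : Function.Injective A.mulVecLin := by
    rw [injective_iff_map_eq_zero]
    intro v hv
    have := hA v
    rw [← Matrix.mulVecLin_apply, hv, norm_zero] at this
    exact norm_le_zero_iff.1 (nonpos_of_mul_nonpos_right this hr)
  have hbij : Function.Bijective A.mulVecLin := ⟨hinj, LinearMap.injective_iff_surjective.1 hinj⟩
  simpa [eq_sub_iff_add_eq] using hbij.existsUnique (c - b)

theorem discL2Norm_le {m : ℕ} {h K : ℝ} (hh : 0 ≤ h) (hK : h * m ≤ K) (v : Fin m → ℝ) :
    discL2Norm h v ≤ Real.sqrt K * ‖v‖ := by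
  have : h * ∑ i, v i ^ 2 ≤ K * ‖v‖ ^ 2 := by
    calc h * ∑ i, v i ^ 2 ≤ h * ∑ _i : Fin m, ‖v‖ ^ 2 := by
          refine mul_le_mul_of_nonneg_left (Finset.sum_le_sum fun i _ => ?_) hh
          rw [← sq_abs]
          exact pow_le_pow_left₀ (abs_nonneg _) (norm_le_pi_norm v i) 2
      _ = h * m * ‖v‖ ^ 2 := by simp; ring
      _ ≤ _ := by gcongr
  calc discL2Norm h v ≤ Real.sqrt (K * ‖v‖ ^ 2) := Real.sqrt_le_sqrt this
    _ = _ := by rw [Real.sqrt_mul' _ (sq_nonneg _), Real.sqrt_sq (norm_nonneg _)]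

/-! ### Consequences of the regularity of the solution -/

theorem IsC1Holder.exists_taylor_bound {α : ℝ≥0} {u : ℝ → ℝ} {a b : ℝ}
    (h : IsC1Holder α u a b) : ∃ K ≥ 0, ∃ u' : ℝ → ℝ, ∀ x ∈ Icc a b, ∀ y ∈ Icc a b,
      |u y - u x - u' x * (y - x)| ≤ K * |y - x| ^ (1 + (α : ℝ)) := by
  obtain ⟨hC1, K, hK⟩ := h
  refine ⟨K, K.2, derivWithin u (Icc a b), fun x hx y hy => ?_⟩
  set u' := derivWithin u (Icc a b)
  have hsub : uIcc x y ⊆ Icc a b := uIcc_subset_Icc hx hy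
  have hd : ∀ z ∈ uIcc x y, HasDerivWithinAt (fun z => u z - u' x * z) (u' z - u' x)
      (uIcc x y) z := fun z hz => by
    have := ((hC1.differentiableOn one_ne_zero) z (hsub hz)).hasDerivWithinAt.mono hsub
    exact (this.sub ((hasDerivWithinAt_id z _).const_mul (u' x))).congr_deriv (by rw [mul_one])
  have hb : ∀ z ∈ uIcc x y, ‖u' z - u' x‖ ≤ K * |y - x| ^ (α : ℝ) := fun z hz => by
    rw [← dist_eq_norm]
    refine hK.dist_le_of_le (hsub hz) hx ?_
    rw [Real.dist_eq]
    exact abs_sub_left_of_mem_uIcc hz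
  have := (convex_uIcc x y).norm_image_sub_le_of_norm_hasDerivWithin_le hd hb
    left_mem_uIcc right_mem_uIcc
  rw [Real.norm_eq_abs, Real.norm_eq_abs] at this
  rw [show u y - u x - u' x * (y - x) = u y - u' x * y - (u x - u' x * x) by ring]
  refine this.trans_eq ?_
  rw [Real.rpow_add' (abs_nonneg _) (by positivity), Real.rpow_one]
  ring

/-- A function satisfying a Hölder–Taylor bound has second differences of order `1 + α`. -/
theorem abs_second_diff_le {u u' : ℝ → ℝ} {a b K p : ℝ}
    (h : ∀ x ∈ Icc a b, ∀ y ∈ Icc a b, |u y - u x - u' x * (y - x)| ≤ K * |y - x| ^ p)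
    {x z : ℝ} (hx : x ∈ Icc a b) (h1 : x - z ∈ Icc a b) (h2 : x + z ∈ Icc a b) :
    |2 * u x - u (x - z) - u (x + z)| ≤ 2 * K * |z| ^ p := by
  have e1 := h x hx _ h1
  have e2 := h x hx _ h2
  rw [sub_sub_cancel_left, abs_neg] at e1
  rw [add_sub_cancel_left] at e2
  rw [show 2 * u x - u (x - z) - u (x + z)
    = -((u (x - z) - u x - u' x * -z) + (u (x + z) - u x - u' x * z)) by ring, abs_neg]
  exact (abs_add_le _ _).trans (by linarith)

/-- The piecewise linear interpolant `∑ u(x_k) φ_k` of `u` on `[-L, L]`, extended by zero. -/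
noncomputable def interp (L : ℝ) (N : ℕ) (u : ℝ → ℝ) (y : ℝ) : ℝ :=
  ∑ k ∈ Finset.range (N + 1), u (node L N k) * nodalBasis L N k y

theorem node_succ (L : ℝ) (N : ℕ) (k : ℤ) : node L N (k + 1) = node L N k + meshSize L N := by
  unfold node; push_cast; ring

theorem node_pred (L : ℝ) (N : ℕ) (k : ℤ) : node L N (k - 1) = node L N k - meshSize L N := by
  unfold node; push_cast; ring

theorem node_zero (L : ℝ) (N : ℕ) : node L N 0 = -L := by simp [node]

theorem node_last (L : ℝ) {N : ℕ} (hN : 0 < N) : node L N N = L := by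
  have : (N : ℝ) ≠ 0 := by positivity
  unfold node meshSize
  push_cast
  field_simp
  ring

theorem node_mono {L : ℝ} (hL : 0 < L) {N : ℕ} (hN : 0 < N) : StrictMono (node L N) := by
  intro i j hij
  have := meshSize_pos hL hN
  have : (i : ℝ) < j := by exact_mod_cast hij
  unfold node
  nlinarith

theorem node_mem_Icc {L : ℝ} (hL : 0 < L) {N : ℕ} (hN : 0 < N) {k : ℤ} (h0 : 0 ≤ k)
    (h1 : k ≤ N) : node L N k ∈ Icc (-L) L := by
  constructor
  · rw [← node_zero L N]; exact (node_mono hL hN).monotone h0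
  · exact ((node_mono hL hN).monotone h1).trans_eq (node_last L hN)

theorem nodalBasis_eq_hat {L : ℝ} {N : ℕ} {k : ℤ} {y : ℝ} (hy : y ∈ Icc (-L) L) :
    nodalBasis L N k y = hat (meshSize L N) (y - node L N k) := by
  unfold nodalBasis
  by_cases h : y ∈ Icc (node L N (k - 1)) (node L N (k + 1))
  · exact indicator_of_mem (show y ∈ _ ∩ _ from ⟨h, hy⟩) _
  · rw [indicator_of_notMem fun h' => h h'.1, hat, if_neg]
    intro hlt
    rw [abs_lt] at hlt
    refine h ⟨?_, ?_⟩
    · rw [node_pred]; linarith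
    · rw [node_succ]; linarith

theorem nodalBasis_eq_zero {L : ℝ} {N : ℕ} {k : ℤ} {y : ℝ} (hy : y ∉ Icc (-L) L) :
    nodalBasis L N k y = 0 :=
  indicator_of_notMem (fun h => hy h.2) _

/-- The basis functions of interior nodes are not affected by the cut-off to `[-L, L]`. -/
theorem nodalBasis_interior {L : ℝ} (hL : 0 < L) {N : ℕ} (hN : 0 < N) {k : ℤ} (h0 : 0 < k)
    (h1 : k < N) (y : ℝ) : nodalBasis L N k y = hat (meshSize L N) (y - node L N k) := by
  by_cases hy : y ∈ Icc (-L) L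
  · exact nodalBasis_eq_hat hy
  · rw [nodalBasis_eq_zero hy, hat, if_neg]
    intro hlt
    rw [abs_lt] at hlt
    have e1 := (node_mono hL hN).monotone (show 0 ≤ k - 1 by omega)
    have e2 := (node_mono hL hN).monotone (show k + 1 ≤ N by omega)
    rw [node_zero, node_pred] at e1
    rw [node_last L hN, node_succ] at e2
    exact hy ⟨by linarith, by linarith⟩

/-- At most two hat functions are active at a point. -/
theorem sum_mul_hat {h : ℝ} (hh : 0 < h) {N m : ℕ} (hm : m < N) {t : ℝ} (ht0 : 0 ≤ t)
    (ht1 : t ≤ 1) (c : ℕ → ℝ) :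
    ∑ k ∈ Finset.range (N + 1), c k * hat h ((m + t - k) * h) = c m * (1 - t) + c (m + 1) * t := by
  have hsub : ({m, m + 1} : Finset ℕ) ⊆ Finset.range (N + 1) := by
    intro k hk
    simp only [Finset.mem_insert, Finset.mem_singleton] at hk
    simp only [Finset.mem_range]
    omega
  rw [← Finset.sum_subset hsub, Finset.sum_pair (by omega)]
  · have e1 : |((m : ℝ) + t - m) * h| = t * h := by
      rw [add_sub_cancel_left]; exact abs_of_nonneg (by positivity)
    have e2 : |((m : ℝ) + t - (m + 1 : ℕ)) * h| = (1 - t) * h := by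
      rw [show ((m : ℝ) + t - (m + 1 : ℕ)) * h = -((1 - t) * h) by push_cast; ring, abs_neg]
      exact abs_of_nonneg (mul_nonneg (by linarith) hh.le)
    rw [hat_eq hh (by rw [e1]; nlinarith), hat_eq hh (by rw [e2]; nlinarith), e1, e2,
      mul_div_cancel_right₀ _ hh.ne', mul_div_cancel_right₀ _ hh.ne']
    ring
  · intro k _ hk
    simp only [Finset.mem_insert, Finset.mem_singleton, not_or] at hk
    rw [hat, if_neg, mul_zero]
    rw [abs_mul, abs_of_pos hh, not_lt]
    refine le_mul_of_one_le_left hh.le ?_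
    rcases lt_or_ge k m with hkm | hkm
    · have : (k : ℝ) + 1 ≤ m := by exact_mod_cast hkm
      exact le_trans (by linarith) (le_abs_self _)
    · have : (m : ℝ) + 2 ≤ k := by exact_mod_cast (by omega : m + 2 ≤ k)
      exact le_trans (by linarith) (neg_le_abs _)

theorem abs_interp_sub_le {L : ℝ} (hL : 0 < L) {N : ℕ} (hN : 0 < N) {u u' : ℝ → ℝ}
    {a b K p : ℝ} (hK : 0 ≤ K) (hp : 0 ≤ p) (hab : Icc (-L) L ⊆ Icc a b)
    (h : ∀ x ∈ Icc a b, ∀ y ∈ Icc a b, |u y - u x - u' x * (y - x)| ≤ K * |y - x| ^ p)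
    {y : ℝ} (hy : y ∈ Ioo (-L) L) : |interp L N u y - u y| ≤ K * meshSize L N ^ p := by
  set η := meshSize L N with hη
  have hη0 : 0 < η := meshSize_pos hL hN
  have hNr : (0 : ℝ) < N := by exact_mod_cast hN
  have hq : 0 ≤ (y + L) / η := div_nonneg (by linarith [hy.1]) hη0.le
  set m := ⌊(y + L) / η⌋₊ with hm
  set t := (y + L) / η - m with ht
  have ht0 : 0 ≤ t := sub_nonneg.2 (Nat.floor_le hq)
  have ht1 : t ≤ 1 := by have := Nat.lt_floor_add_one ((y + L) / η); linarith
  have hmN : m < N := by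
    rw [hm, Nat.floor_lt hq, div_lt_iff₀ hη0, hη, meshSize]
    rw [mul_div_cancel₀ _ hNr.ne']
    linarith [hy.2]
  have hyt : y = -L + (m + t) * η := by
    rw [ht]; field_simp; ring
  have hI : interp L N u y = u (node L N m) * (1 - t) + u (node L N (m + 1 : ℕ)) * t := by
    rw [← sum_mul_hat hη0 hmN ht0 ht1 (fun k => u (node L N k)), interp]
    refine Finset.sum_congr rfl fun k _ => ?_
    rw [nodalBasis_eq_hat (Ioo_subset_Icc_self hy), ← hη]
    congr 2
    rw [hyt, node]
    push_cast
    ring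
  have e1 := h y (hab (Ioo_subset_Icc_self hy)) _
    (hab (node_mem_Icc hL hN (k := (m : ℤ)) (by omega) (by omega)))
  have e2 := h y (hab (Ioo_subset_Icc_self hy)) _
    (hab (node_mem_Icc hL hN (k := ((m + 1 : ℕ) : ℤ)) (by omega) (by omega)))
  have d1 : node L N (m : ℤ) - y = -(t * η) := by
    rw [hyt, node]; push_cast; ring
  have d2 : node L N ((m + 1 : ℕ) : ℤ) - y = (1 - t) * η := by
    rw [hyt, node]; push_cast; ring
  have b1 : |node L N (m : ℤ) - y| ^ p ≤ η ^ p := by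
    refine Real.rpow_le_rpow (abs_nonneg _) ?_ hp
    rw [d1, abs_neg, abs_of_nonneg (by positivity)]
    nlinarith
  have b2 : |node L N ((m + 1 : ℕ) : ℤ) - y| ^ p ≤ η ^ p := by
    refine Real.rpow_le_rpow (abs_nonneg _) ?_ hp
    rw [d2, abs_of_nonneg (mul_nonneg (by linarith) hη0.le)]
    nlinarith
  replace e1 := e1.trans (mul_le_mul_of_nonneg_left b1 hK)
  replace e2 := e2.trans (mul_le_mul_of_nonneg_left b2 hK)
  -- the weights `1 - t` and `t` reproduce linear functions, so the first-order terms cancel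
  rw [hI, show u (node L N m) * (1 - t) + u (node L N (m + 1 : ℕ)) * t - u y
    = (1 - t) * (u (node L N m) - u y - u' y * (node L N m - y))
      + t * (u (node L N (m + 1 : ℕ)) - u y - u' y * (node L N (m + 1 : ℕ) - y)) by
    rw [d1, d2]; ring]
  calc _ ≤ (1 - t) * |u (node L N m) - u y - u' y * (node L N m - y)|
      + t * |u (node L N (m + 1 : ℕ)) - u y - u' y * (node L N (m + 1 : ℕ) - y)| := by
        refine (abs_add_le _ _).trans_eq ?_
        rw [abs_mul, abs_mul, abs_of_nonneg ht0, abs_of_nonneg (by linarith : 0 ≤ 1 - t)]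
    _ ≤ (1 - t) * (K * η ^ p) + t * (K * η ^ p) := by
        gcongr
    _ = _ := by ring

/-! ### Consistency of the discrete operator -/

theorem integral_comp_sub_div {h : ℝ} (hh : 0 < h) (F : ℝ → ℝ) (x : ℝ) :
    ∫ y, F ((x - y) / h) = h * ∫ t, F t := by
  rw [integral_sub_left_eq_self (fun z => F (z / h)) volume x, Measure.integral_comp_div,
    abs_of_pos hh, smul_eq_mul]

theorem integrable_comp_sub_div {h : ℝ} (hh : 0 < h) {F : ℝ → ℝ} (hF : Integrable F) (x : ℝ) :
    Integrable fun y => F ((x - y) / h) :=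
  (hF.comp_div hh.ne').comp_sub_left x

/-- The discrete operator is bounded on bounded functions, with norm of order `h^{-2s}`. -/
theorem abs_integral_dkern_mul_le {s : ℝ} (hs0 : 0 < s) (hs1 : s < 1) (hs : s ≠ 1 / 2) {h : ℝ}
    (hh : 0 < h) {e : ℝ → ℝ} {E : ℝ} (he : ∀ᵐ y, |e y| ≤ E) (x : ℝ) :
    |∫ y, h ^ (-1 - 2 * s) * dkern s ((x - y) / h) * e y|
      ≤ E * h ^ (-(2 * s)) * ∫ t, |dkern s t| := by
  have hp : 0 < h ^ (-1 - 2 * s) := Real.rpow_pos_of_pos hh _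
  have hi := integrable_comp_sub_div hh (integrable_dkern hs0 hs1 hs).norm x
  have := norm_integral_le_of_norm_le (hi.const_mul (E * h ^ (-1 - 2 * s)))
    (f := fun y => h ^ (-1 - 2 * s) * dkern s ((x - y) / h) * e y) ?_
  · refine this.trans_eq ?_
    rw [integral_const_mul, integral_comp_sub_div hh (fun t => ‖dkern s t‖),
      show -(2 * s) = -1 - 2 * s + 1 by ring, Real.rpow_add_one hh.ne']
    simp only [Real.norm_eq_abs]
    ring
  · filter_upwards [he] with y hy
    rw [norm_mul, norm_mul, Real.norm_of_nonneg hp.le, Real.norm_eq_abs (e y)]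
    calc _ ≤ h ^ (-1 - 2 * s) * ‖dkern s ((x - y) / h)‖ * E := by gcongr
      _ = _ := by ring

/-- Convolution of an even kernel with `u x - u` only sees second differences of `u`. -/
theorem abs_integral_even_mul_le {J B u : ℝ → ℝ} {x A M p : ℝ} (hJ : Integrable J)
    (heven : ∀ z, J (-z) = J z) (hu : AEStronglyMeasurable u) (hM : ∀ᵐ y, |u y| ≤ M)
    (hD : ∀ᵐ z, |2 * u x - u (x - z) - u (x + z)| ≤ 2 * A * |z| ^ p)
    (hB : ∀ z, |J z| ≤ B z) (hBi : Integrable fun z => B z * |z| ^ p) :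
    |∫ y, J (x - y) * (u x - u y)| ≤ A * ∫ z, B z * |z| ^ p := by
  have e1 : ∫ y, J (x - y) * (u x - u y) = ∫ z, J z * (u x - u (x - z)) := by
    rw [← integral_sub_left_eq_self (fun z => J z * (u x - u (x - z))) volume x]
    simp only [sub_sub_cancel]
  have e2 : ∫ z, J z * (u x - u (x - z)) = ∫ z, J z * (u x - u (x + z)) := by
    rw [← integral_neg_eq_self]
    simp only [heven, sub_neg_eq_add]
  have hQm := (volume.measurePreserving_sub_left x).quasiMeasurePreserving
  have hQp := (measurePreserving_add_left volume x).quasiMeasurePreserving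
  have hbound : ∀ v : ℝ → ℝ, AEStronglyMeasurable v → (∀ᵐ z, |v z| ≤ M) →
      Integrable fun z => J z * (u x - v z) := fun v hv hvM => by
    refine hJ.mul_bdd (c := |u x| + M) (aestronglyMeasurable_const.sub hv) ?_
    filter_upwards [hvM] with z hz
    exact (norm_sub_le _ _).trans (add_le_add le_rfl hz)
  have i1 := hbound (fun z => u (x - z)) (hu.comp_quasiMeasurePreserving hQm) (hQm.ae hM)
  have i2 := hbound (fun z => u (x + z)) (hu.comp_quasiMeasurePreserving hQp) (hQp.ae hM)
  have e3 : 2 * ∫ y, J (x - y) * (u x - u y)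
      = ∫ z, J z * (2 * u x - u (x - z) - u (x + z)) := by
    calc _ = (∫ z, J z * (u x - u (x - z))) + ∫ z, J z * (u x - u (x + z)) := by
          rw [← e2, ← e1, two_mul]
      _ = _ := by
          rw [← integral_add i1 i2]
          congr 1; ext z; ring
  have := norm_integral_le_of_norm_le (hBi.const_mul (2 * A))
    (f := fun z => J z * (2 * u x - u (x - z) - u (x + z))) ?_
  · rw [← e3, integral_const_mul, norm_mul, Real.norm_two, Real.norm_eq_abs] at this
    linarith
  · filter_upwards [hD] with z hz
    rw [norm_mul]
    calc _ ≤ B z * (2 * A * |z| ^ p) :=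
          mul_le_mul (hB z) hz (abs_nonneg _) ((abs_nonneg _).trans (hB z))
      _ = _ := by ring

theorem integrable_truncated_kernel {s ε : ℝ} (hs0 : 0 < s) (hε : 0 < ε) :
    Integrable ({z : ℝ | ε < |z|}.indicator fun z => |z| ^ (-1 - 2 * s)) := by
  have hms : MeasurableSet {z : ℝ | ε < |z|} :=
    measurableSet_lt measurable_const continuous_abs.measurable
  refine integrable_of_even_of_decay (r := -1 - 2 * s) (C := 1) ?_ (fun t => ?_) (by linarith)
    fun t ht => ?_
  · refine (locallyIntegrable_const (ε ^ (-1 - 2 * s))).mono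
      (Measurable.aestronglyMeasurable (Measurable.indicator (by fun_prop) hms))
      (ae_of_all _ fun z => ?_)
    rw [Real.norm_of_nonneg (Real.rpow_nonneg hε.le _)]
    by_cases hz : z ∈ {z : ℝ | ε < |z|}
    · rw [indicator_of_mem hz, Real.norm_of_nonneg (Real.rpow_nonneg (abs_nonneg _) _)]
      exact Real.rpow_le_rpow_of_nonpos hε (le_of_lt hz) (by linarith)
    · rw [indicator_of_notMem hz, norm_zero]
      exact Real.rpow_nonneg hε.le _
  · simp only [indicator, mem_ofPred_eq, abs_neg]
  · rw [one_mul, ← Real.norm_eq_abs]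
    refine (norm_indicator_le_norm_self _ _).trans_eq ?_
    rw [abs_of_pos (by linarith : (0 : ℝ) < t), Real.norm_of_nonneg
      (Real.rpow_nonneg (by linarith) _)]

/-- Both the discrete operator and the truncated fractional Laplacian annihilate constants, so
their difference only involves second differences of `u`; the bound is uniform in the truncation
radius. -/
theorem abs_truncated_sub_le {s : ℝ} (hs0 : 0 < s) (hs1 : s < 1) (hs : s ≠ 1 / 2) {h ε : ℝ}
    (hε : 0 < ε) (hεh : ε ≤ h) {u : ℝ → ℝ} {x A M α : ℝ}
    (hα0 : 0 < α) (hα : 2 * s - 1 < α) (hα1 : α ≤ 1)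
    (hu : AEStronglyMeasurable u) (hM : ∀ᵐ y, |u y| ≤ M)
    (hD : ∀ᵐ z, |2 * u x - u (x - z) - u (x + z)| ≤ 2 * A * |z| ^ (1 + α)) :
    |(fracConst s * ∫ y in {y | ε < |x - y|}, (u x - u y) / |x - y| ^ (1 + 2 * s)) -
      ∫ y, h ^ (-1 - 2 * s) * dkern s ((x - y) / h) * u y|
      ≤ A * (h ^ (1 + α - 2 * s) * ∫ t, kernDefect s t * |t| ^ (1 + α)) := by
  have hh : 0 < h := hε.trans_le hεh
  have hc := fracConst_pos hs0 hs1
  have hp : 0 < h ^ (-1 - 2 * s) := Real.rpow_pos_of_pos hh _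
  set P : ℝ → ℝ := {z : ℝ | ε < |z|}.indicator fun z => |z| ^ (-1 - 2 * s) with hP
  have hPi : Integrable P := integrable_truncated_kernel hs0 hε
  have hdk : Integrable fun z => h ^ (-1 - 2 * s) * dkern s (z / h) :=
    ((integrable_dkern hs0 hs1 hs).comp_div hh.ne').const_mul _
  set J : ℝ → ℝ := fun z => h ^ (-1 - 2 * s) * dkern s (z / h) + fracConst s * P z with hJ
  have hJi : Integrable J := hdk.add (hPi.const_mul _)
  have hJe : ∀ z, J (-z) = J z := fun z => by
    simp only [hJ, hP, indicator, mem_ofPred_eq, abs_neg, neg_div, dkern_neg]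
  set B : ℝ → ℝ := fun z => h ^ (-1 - 2 * s) * kernDefect s (z / h) with hB
  have hJB : ∀ z, |J z| ≤ B z := fun z => by
    have hz : |z| ^ (-1 - 2 * s) = h ^ (-1 - 2 * s) * |z / h| ^ (-1 - 2 * s) := by
      rw [← Real.mul_rpow hh.le (abs_nonneg _), abs_div, abs_of_pos hh, mul_div_cancel₀ _ hh.ne']
    have hn : 0 ≤ |z / h| ^ (-1 - 2 * s) := Real.rpow_nonneg (abs_nonneg _) _
    simp only [hJ, hB, kernDefect]
    by_cases hzε : z ∈ {z : ℝ | ε < |z|}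
    · rw [hP, indicator_of_mem hzε, hz, show h ^ (-1 - 2 * s) * dkern s (z / h)
        + fracConst s * (h ^ (-1 - 2 * s) * |z / h| ^ (-1 - 2 * s))
        = h ^ (-1 - 2 * s) * (dkern s (z / h) + fracConst s * |z / h| ^ (-1 - 2 * s)) by ring,
        abs_mul, abs_of_pos hp]
      refine mul_le_mul_of_nonneg_left (le_add_of_nonneg_right ?_) hp.le
      exact indicator_nonneg (fun t _ => mul_nonneg hc.le (Real.rpow_nonneg (abs_nonneg _) _)) _
    · rw [hP, indicator_of_notMem hzε, mul_zero, add_zero, abs_mul, abs_of_pos hp]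
      refine mul_le_mul_of_nonneg_left ?_ hp.le
      have hz1 : z / h ∈ Icc (-1 : ℝ) 1 := by
        rw [mem_Icc, ← abs_le, abs_div, abs_of_pos hh, div_le_one hh]
        exact (not_lt.1 hzε).trans hεh
      rw [indicator_of_mem hz1]
      calc |dkern s (z / h)| = |dkern s (z / h) + fracConst s * |z / h| ^ (-1 - 2 * s)
            - fracConst s * |z / h| ^ (-1 - 2 * s)| := by rw [add_sub_cancel_right]
        _ ≤ _ := (abs_sub _ _).trans_eq (by rw [abs_of_nonneg (mul_nonneg hc.le hn)])
  have hscale : ∀ z, B z * |z| ^ (1 + α)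
      = h ^ (α - 2 * s) * (kernDefect s (z / h) * |z / h| ^ (1 + α)) := fun z => by
    have : |z| ^ (1 + α) = h ^ (1 + α) * |z / h| ^ (1 + α) := by
      rw [← Real.mul_rpow hh.le (abs_nonneg _), abs_div, abs_of_pos hh, mul_div_cancel₀ _ hh.ne']
    rw [this, show α - 2 * s = -1 - 2 * s + (1 + α) by ring,
      Real.rpow_add hh (-1 - 2 * s) (1 + α)]
    simp only [hB]
    ring
  have hint := integrable_kernDefect_mul hs0 hs1 hs hα0 hα hα1
  have hBi : Integrable fun z => B z * |z| ^ (1 + α) := by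
    simp only [hscale]
    exact (hint.comp_div hh.ne').const_mul _
  have hBint : ∫ z, B z * |z| ^ (1 + α)
      = h ^ (1 + α - 2 * s) * ∫ t, kernDefect s t * |t| ^ (1 + α) := by
    simp only [hscale]
    rw [integral_const_mul,
      Measure.integral_comp_div (fun t => kernDefect s t * |t| ^ (1 + α)) h, abs_of_pos hh,
      smul_eq_mul, ← mul_assoc, ← Real.rpow_add_one hh.ne']
    congr 2; ring
  have main := abs_integral_even_mul_le hJi hJe hu hM hD hJB hBi
  rw [hBint] at main
  refine le_of_eq_of_le (congrArg _ ?_) main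
  -- split the kernel `J` into its two parts
  have hdkx : Integrable fun y => h ^ (-1 - 2 * s) * dkern s ((x - y) / h) := hdk.comp_sub_left x
  have hbdd : ∀ᵐ y, ‖u x - u y‖ ≤ |u x| + M := by
    filter_upwards [hM] with y hy
    exact (norm_sub_le _ _).trans (add_le_add le_rfl hy)
  have i1 : Integrable fun y => h ^ (-1 - 2 * s) * dkern s ((x - y) / h) * (u x - u y) :=
    hdkx.mul_bdd (aestronglyMeasurable_const.sub hu) hbdd
  have i2 : Integrable fun y => fracConst s * P (x - y) * (u x - u y) :=
    ((hPi.comp_sub_left x).const_mul _).mul_bdd (aestronglyMeasurable_const.sub hu) hbdd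
  have i3 : Integrable fun y => h ^ (-1 - 2 * s) * dkern s ((x - y) / h) * u y :=
    hdkx.mul_bdd hu hM
  have z1 : ∫ y, h ^ (-1 - 2 * s) * dkern s ((x - y) / h) * (u x - u y)
      = -∫ y, h ^ (-1 - 2 * s) * dkern s ((x - y) / h) * u y := by
    simp only [mul_sub]
    rw [integral_sub (hdkx.mul_const _) i3, integral_mul_const, integral_const_mul,
      integral_comp_sub_div hh, integral_dkern hs0 hs1 hs]
    ring
  have z2 : ∫ y, fracConst s * P (x - y) * (u x - u y)
      = fracConst s * ∫ y in {y | ε < |x - y|}, (u x - u y) / |x - y| ^ (1 + 2 * s) := by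
    have hms : MeasurableSet {y : ℝ | ε < |x - y|} :=
      measurableSet_lt measurable_const (by fun_prop)
    rw [← integral_indicator hms, ← integral_const_mul]
    congr 1; ext y
    rw [mul_assoc]
    congr 1
    by_cases hy : ε < |x - y|
    · rw [hP, indicator_of_mem (show x - y ∈ {z : ℝ | ε < |z|} from hy),
        indicator_of_mem (show y ∈ {y : ℝ | ε < |x - y|} from hy),
        show -1 - 2 * s = -(1 + 2 * s) by ring, Real.rpow_neg (abs_nonneg _)]
      ring
    · rw [hP, indicator_of_notMem (show x - y ∉ {z : ℝ | ε < |z|} from hy),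
        indicator_of_notMem (show y ∉ {y : ℝ | ε < |x - y|} from hy), zero_mul]
  simp only [hJ, add_mul]
  rw [integral_add i1 i2, z1, z2]
  ring

/-- The principal value limit of `abs_truncated_sub_le`. -/
theorem abs_fracLaplacian_sub_le {s : ℝ} (hs0 : 0 < s) (hs1 : s < 1) (hs : s ≠ 1 / 2) {h : ℝ}
    (hh : 0 < h) {u : ℝ → ℝ} {x l A M α : ℝ}
    (hα0 : 0 < α) (hα : 2 * s - 1 < α) (hα1 : α ≤ 1)
    (hu : AEStronglyMeasurable u) (hM : ∀ᵐ y, |u y| ≤ M)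
    (hD : ∀ᵐ z, |2 * u x - u (x - z) - u (x + z)| ≤ 2 * A * |z| ^ (1 + α))
    (hl : HasFracLaplacianAt s u x l) :
    |l - ∫ y, h ^ (-1 - 2 * s) * dkern s ((x - y) / h) * u y|
      ≤ A * (h ^ (1 + α - 2 * s) * ∫ t, kernDefect s t * |t| ^ (1 + α)) := by
  refine le_of_tendsto (hl.2.sub_const _).abs ?_
  filter_upwards [Ioc_mem_nhdsGT hh] with ε hε
  exact abs_truncated_sub_le hs0 hs1 hs hε.1 hε.2 hα0 hα hα1 hu hM hD

/-! ### The residual of the exact solution -/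

theorem exists_ae_bound_of_memLp_top {g : ℝ → ℝ} (hg : MemLp g ⊤ volume) :
    ∃ M, ∀ᵐ y, |g y| ≤ M := by
  refine ⟨(eLpNormEssSup g volume).toReal, ?_⟩
  have hfin : eLpNormEssSup g volume ≠ ⊤ := by
    have := hg.eLpNorm_lt_top.ne
    rwa [eLpNorm_exponent_top] at this
  filter_upwards [ae_le_eLpNormEssSup (f := g) (μ := volume)] with y hy
  have := ENNReal.toReal_mono hfin hy
  rwa [toReal_enorm, Real.norm_eq_abs] at this

/-- The class of essentially bounded functions with bounded support, in which all convolutions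
with the Riesz kernel are taken. -/
structure IsBddCompact (w : ℝ → ℝ) : Prop where
  aesm : AEStronglyMeasurable w
  bdd : ∃ M, ∀ᵐ y, |w y| ≤ M
  supp : ∃ a b, Function.support w ⊆ Icc a b

theorem IsBddCompact.add {v w : ℝ → ℝ} (hv : IsBddCompact v) (hw : IsBddCompact w) :
    IsBddCompact fun y => v y + w y := by
  obtain ⟨M, hM⟩ := hv.bdd
  obtain ⟨M', hM'⟩ := hw.bdd
  obtain ⟨a, b, hab⟩ := hv.supp
  obtain ⟨a', b', hab'⟩ := hw.supp
  refine ⟨hv.aesm.add hw.aesm, ⟨M + M', ?_⟩, min a a', max b b', ?_⟩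
  · filter_upwards [hM, hM'] with y h h'
    exact (abs_add_le _ _).trans (add_le_add h h')
  · intro y hy
    by_cases h : v y = 0
    · by_cases h' : w y = 0
      · simp [h, h'] at hy
      · exact Icc_subset_Icc (min_le_right _ _) (le_max_right _ _) (hab' h')
    · exact Icc_subset_Icc (min_le_left _ _) (le_max_left _ _) (hab h)

theorem IsBddCompact.const_mul {w : ℝ → ℝ} (hw : IsBddCompact w) (c : ℝ) :
    IsBddCompact fun y => c * w y := by
  obtain ⟨M, hM⟩ := hw.bdd
  obtain ⟨a, b, hab⟩ := hw.supp
  refine ⟨hw.aesm.const_mul c, ⟨|c| * M, ?_⟩, a, b, fun y hy => hab (right_ne_zero_of_mul hy)⟩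
  filter_upwards [hM] with y h
  rw [abs_mul]
  exact mul_le_mul_of_nonneg_left h (abs_nonneg c)

theorem IsBddCompact.sum {ι : Type*} (t : Finset ι) {w : ι → ℝ → ℝ}
    (hw : ∀ i, IsBddCompact (w i)) : IsBddCompact fun y => ∑ i ∈ t, w i y := by
  classical
  induction t using Finset.induction_on with
  | empty =>
    simp only [Finset.sum_empty]
    exact ⟨aestronglyMeasurable_const, ⟨0, by simp⟩, 0, 0, by simp⟩
  | insert i t hi ih =>
    simp only [Finset.sum_insert hi]
    exact (hw i).add ih

theorem IsBddCompact.integrable_kern_mul {s : ℝ} (hs1 : s < 1) {w : ℝ → ℝ} (hw : IsBddCompact w)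
    (c : ℝ) : Integrable fun y => kern s (c - y) * w y := by
  obtain ⟨M, hM⟩ := hw.bdd
  obtain ⟨a, b, hab⟩ := hw.supp
  have h1 : IntervalIntegrable (kern s) volume (c - a) (c - b) :=
    ((locallyIntegrable_kern hs1).integrableOn_isCompact isCompact_uIcc).intervalIntegrable
  have h2 := h1.comp_sub_left c
  rw [sub_sub_cancel, sub_sub_cancel] at h2
  rcases le_or_gt a b with hle | hlt
  · rw [intervalIntegrable_iff_integrableOn_Ioc_of_le hle, ← integrableOn_Icc_iff_integrableOn_Ioc]
      at h2
    rw [← integrableOn_iff_integrable_of_support_subset (s := Icc a b)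
      (fun y hy => hab (right_ne_zero_of_mul hy))]
    exact h2.mul_bdd hw.aesm.restrict (ae_restrict_of_ae hM)
  · have : ∀ y, w y = 0 := fun y => by
      by_contra h
      have := hab h
      rw [Icc_eq_empty (not_le.2 hlt)] at this
      exact this
    simp [this]

theorem isBddCompact_nodalBasis {L : ℝ} (hL : 0 < L) {N : ℕ} (hN : 0 < N) (k : ℤ) :
    IsBddCompact (nodalBasis L N k) := by
  have hh := meshSize_pos hL hN
  refine ⟨?_, ⟨1, ae_of_all _ fun y => ?_⟩, -L, L, fun y hy => ?_⟩
  · have := (continuous_hat hh).measurable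
    exact (Measurable.indicator (by fun_prop)
      (measurableSet_Icc.inter measurableSet_Icc)).aestronglyMeasurable
  · rw [← Real.norm_eq_abs, nodalBasis]
    refine (norm_indicator_le_norm_self _ y).trans ?_
    rw [Real.norm_of_nonneg (hat_nonneg hh _), hat_eq_max hh]
    exact max_le (sub_le_self _ (by positivity)) zero_le_one
  · by_contra h
    exact hy (nodalBasis_eq_zero h)

/-- The solution of the Dirichlet problem is essentially bounded with bounded support. -/
theorem isBddCompact_solution {L : ℝ} {g u : ℝ → ℝ} (hg : MemLp g ⊤ volume)
    (hgs : Bornology.IsBounded (Function.support g)) (hu : ContinuousOn u (Icc (-L) L))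
    (hug : ∀ x, x ∉ Icc (-L) L → u x = g x) : IsBddCompact u := by
  have hu_eq : u = (Icc (-L) L).indicator u + (Icc (-L) L)ᶜ.indicator g := by
    rw [← indicator_self_add_compl (Icc (-L) L) u]
    congr 1
    · rw [indicator_self_add_compl]
    · exact indicator_congr fun x hx => hug x hx
  obtain ⟨M, hM⟩ := isCompact_Icc.exists_bound_of_continuousOn hu
  obtain ⟨M', hM'⟩ := exists_ae_bound_of_memLp_top hg
  obtain ⟨r, hr⟩ := hgs.subset_closedBall 0
  refine ⟨?_, ⟨max M M', ?_⟩, min (-L) (-r), max L r, fun x hx => ?_⟩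
  · rw [hu_eq]
    exact ((aestronglyMeasurable_indicator_iff measurableSet_Icc).2
      (hu.aestronglyMeasurable measurableSet_Icc)).add
      (hg.1.indicator measurableSet_Icc.compl)
  · filter_upwards [hM'] with y hy
    by_cases h : y ∈ Icc (-L) L
    · exact (hM y h).trans (le_max_left _ _)
    · rw [hug y h]; exact hy.trans (le_max_right _ _)
  · by_cases h : x ∈ Icc (-L) L
    · exact Icc_subset_Icc (min_le_left _ _) (le_max_left _ _) h
    · have : g x ≠ 0 := hug x h ▸ hx
      have := hr this
      rw [Real.closedBall_eq_Icc, zero_sub, zero_add] at this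
      exact Icc_subset_Icc (min_le_right _ _) (le_max_right _ _) this

theorem omegaBar_eq_integral_nodalBasis (s : ℝ) {L : ℝ} (hL : 0 < L) {N : ℕ} (hN : 0 < N)
    (k : ℤ) {m : ℤ} (h0 : 0 < m) (h1 : m < N) :
    omegaBar s (meshSize L N) (k - m) = ∫ y, kern s (node L N k - y) * nodalBasis L N m y := by
  have hh := meshSize_pos hL hN
  simp only [nodalBasis_interior hL hN h0 h1]
  have e := integral_sub_right_eq_self (μ := volume)
    (fun t => kern s (node L N k - node L N m - t) * hat (meshSize L N) t) (node L N m)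
  simp only [sub_sub, add_sub_cancel] at e
  rw [e, omegaBar_eq, intervalIntegral.integral_of_le (by linarith),
    setIntegral_eq_integral_of_forall_compl_eq_zero]
  · congr 1; ext t
    congr 2
    unfold node; push_cast; ring
  · intro t ht
    rw [hat, if_neg, mul_zero]
    intro hlt
    rw [abs_lt] at hlt
    exact ht ⟨hlt.1, hlt.2.le⟩

theorem sum_range_succ_eq {N : ℕ} (hN : 0 < N) (F : ℕ → ℝ) :
    ∑ k ∈ Finset.range (N + 1), F k = F 0 + ∑ j ∈ Finset.range (N - 1), F (j + 1) + F N := by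
  obtain ⟨n, rfl⟩ : ∃ n, N = n + 1 := ⟨N - 1, by omega⟩
  rw [Finset.sum_range_succ, Finset.sum_range_succ', Nat.add_sub_cancel]
  ring

/-- The unmodified scheme is the convolution of the Riesz kernel with the interpolant of the
solution, extended by the exterior data. -/
theorem sum_omegaBar_add_remainder {s : ℝ} (hs1 : s < 1) {L : ℝ} (hL : 0 < L) {N : ℕ} (hN : 0 < N)
    {g : ℝ → ℝ} (hg : IsBddCompact g) (u : ℝ → ℝ) (k : ℤ) :
    ∑ j ∈ Finset.range (N - 1), omegaBar s (meshSize L N) (k - ((j : ℤ) + 1)) *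
        u (node L N ((j : ℤ) + 1)) + remainder s L N g u k
      = ∫ y, kern s (node L N k - y) * (interp L N u y + g y) := by
  have hφ := fun m : ℤ => (isBddCompact_nodalBasis hL hN m).integrable_kern_mul hs1 (node L N k)
  have hgi := hg.integrable_kern_mul hs1 (node L N k)
  have e1 : remainder s L N g u k
      = ∫ y, (u (node L N 0) * (kern s (node L N k - y) * nodalBasis L N 0 y)
        + u (node L N N) * (kern s (node L N k - y) * nodalBasis L N N y))
        + kern s (node L N k - y) * g y := by
    unfold remainder
    rw [← integral_const_mul]
    congr 1; ext y
    unfold kern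
    ring
  have e2 : ∫ y, kern s (node L N k - y) * (interp L N u y + g y)
      = ∫ y, (∑ m ∈ Finset.range (N + 1),
        u (node L N m) * (kern s (node L N k - y) * nodalBasis L N m y))
        + kern s (node L N k - y) * g y := by
    congr 1; ext y
    rw [interp, mul_add, Finset.mul_sum]
    congr 1
    exact Finset.sum_congr rfl fun _ _ => by ring
  have i1 : Integrable fun y => u (node L N 0) * (kern s (node L N k - y) * nodalBasis L N 0 y)
      + u (node L N N) * (kern s (node L N k - y) * nodalBasis L N N y) :=
    ((hφ 0).const_mul _).add ((hφ N).const_mul _)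
  rw [e1, e2, integral_add i1 hgi,
    integral_add ((hφ 0).const_mul _) ((hφ N).const_mul _),
    integral_add (integrable_finsetSum _ fun (m : ℕ) _ => (hφ m).const_mul _) hgi,
    integral_finsetSum _ fun (m : ℕ) _ => (hφ m).const_mul _,
    sum_range_succ_eq hN, integral_const_mul, integral_const_mul]
  have e3 : ∑ j ∈ Finset.range (N - 1), omegaBar s (meshSize L N) (k - ((j : ℤ) + 1)) *
        u (node L N ((j : ℤ) + 1))
      = ∑ j ∈ Finset.range (N - 1), ∫ y, u (node L N ((j + 1 : ℕ) : ℤ)) *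
        (kern s (node L N k - y) * nodalBasis L N ((j + 1 : ℕ) : ℤ) y) := by
    refine Finset.sum_congr rfl fun j hj => ?_
    have hj' := Finset.mem_range.1 hj
    rw [omegaBar_eq_integral_nodalBasis s hL hN k (m := (j : ℤ) + 1) (by omega) (by omega),
      integral_const_mul]
    push_cast
    ring
  rw [e3, integral_const_mul]
  push_cast
  ring

theorem discNegLaplacian_add (h : ℝ) (v w : ℤ → ℝ) (i : ℤ) :
    discNegLaplacian h (fun k => v k + w k) i
      = discNegLaplacian h v i + discNegLaplacian h w i := by
  unfold discNegLaplacian; ring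

theorem discNegLaplacian_sum (h : ℝ) {ι : Type*} (t : Finset ι) (v : ι → ℤ → ℝ) (c : ι → ℝ)
    (i : ℤ) : discNegLaplacian h (fun k => ∑ j ∈ t, v j k * c j) i
      = ∑ j ∈ t, discNegLaplacian h (v j) i * c j := by
  unfold discNegLaplacian
  rw [Finset.mul_sum, ← Finset.sum_sub_distrib, ← Finset.sum_add_distrib,
    ← Finset.sum_neg_distrib, Finset.sum_div]
  exact Finset.sum_congr rfl fun j _ => by ring

/-- The scheme applied to the exact nodal values: the discrete operator acting on the extended
interpolant, plus the effect of the modified central weight. -/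
theorem schemeMatrix_mulVec_add {s : ℝ} (hs1 : s < 1) {L : ℝ} (hL : 0 < L) {N : ℕ} (hN : 0 < N)
    {g : ℝ → ℝ} (hg : IsBddCompact g) (u : ℝ → ℝ) (i : Fin (N - 1)) :
    ((schemeMatrix s L N).mulVec (nodalValues L N u) + boundaryVector s L N g u) i
      = (∫ y, meshSize L N ^ (-1 - 2 * s) *
          dkern s ((node L N ((i : ℤ) + 1) - y) / meshSize L N) * (interp L N u y + g y))
        + (omegaBarM s (meshSize L N) 0 - omegaBar s (meshSize L N) 0) *
          discNegLaplacian (meshSize L N) (fun k => u (node L N k)) ((i : ℤ) + 1) := by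
  have hh := meshSize_pos hL hN
  have hi := i.2
  set h := meshSize L N with hdef
  set S : ℤ → ℝ := fun k => ∑ j ∈ Finset.range (N - 1),
    omegaBarM s h (k - ((j : ℤ) + 1)) * u (node L N ((j : ℤ) + 1)) + remainderM s L N g u k with hS
  have h1 : ((schemeMatrix s L N).mulVec (nodalValues L N u) + boundaryVector s L N g u) i
      = discNegLaplacian h S ((i : ℤ) + 1) := by
    rw [hS, discNegLaplacian_add, discNegLaplacian_sum, Pi.add_apply]
    congr 1
    have : (schemeMatrix s L N).mulVec (nodalValues L N u) i
        = ∑ j ∈ Finset.range (N - 1), weightM s h ((i : ℤ) - j) * u (node L N ((j : ℤ) + 1)) := by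
      rw [Matrix.mulVec, dotProduct]
      rw [← Fin.sum_univ_eq_sum_range
        (fun j : ℕ => weightM s h ((i : ℤ) - j) * u (node L N ((j : ℤ) + 1)))]
      refine Finset.sum_congr rfl fun j _ => ?_
      rw [schemeMatrix_apply, nodalValues]
    rw [this]
    refine Finset.sum_congr rfl fun j _ => ?_
    simp only [weightM, discNegLaplacian]
    rw [show (i : ℤ) + 1 - 1 - ((j : ℤ) + 1) = i - j - 1 by ring,
      show (i : ℤ) + 1 - ((j : ℤ) + 1) = i - j by ring,
      show (i : ℤ) + 1 + 1 - ((j : ℤ) + 1) = i - j + 1 by ring]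
  have h2 : ∀ k : ℤ, 0 ≤ k → k ≤ N → S k
      = (∫ y, kern s (node L N k - y) * (interp L N u y + g y))
        + (omegaBarM s h 0 - omegaBar s h 0) * u (node L N k) := by
    intro k hk0 hkN
    rw [← sum_omegaBar_add_remainder hs1 hL hN hg u k, ← hdef]
    simp only [hS, remainderM, ← hdef]
    have hterm : ∀ j : ℕ, omegaBarM s h (k - ((j : ℤ) + 1)) * u (node L N ((j : ℤ) + 1))
        = omegaBar s h (k - ((j : ℤ) + 1)) * u (node L N ((j : ℤ) + 1))
          + if k = (j : ℤ) + 1 then (omegaBarM s h 0 - omegaBar s h 0) * u (node L N k) else 0 := by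
      intro j
      by_cases hkj : k = (j : ℤ) + 1
      · rw [if_pos hkj, hkj, sub_self]; ring
      · rw [if_neg hkj, add_zero, omegaBarM, if_neg]
        rintro ⟨h', -⟩
        exact hkj (by omega)
    rw [Finset.sum_congr rfl fun j _ => hterm j, Finset.sum_add_distrib]
    -- the modified weight acts at `j + 1 = k` inside, and through `remainderM` at the two ends
    have hsum : (∑ j ∈ Finset.range (N - 1), if k = (j : ℤ) + 1 then
          (omegaBarM s h 0 - omegaBar s h 0) * u (node L N k) else 0)
        + (if k = 0 ∨ k = N then (omegaBarM s h 0 - omegaBar s h 0) * u (node L N k) else 0)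
        = (omegaBarM s h 0 - omegaBar s h 0) * u (node L N k) := by
      by_cases hb : k = 0 ∨ k = N
      · rw [if_pos hb, Finset.sum_eq_zero, zero_add]
        intro j hj
        have := Finset.mem_range.1 hj
        exact if_neg (by omega)
      · rw [if_neg hb, add_zero, Finset.sum_eq_single (k - 1).toNat]
        · rw [if_pos (by omega)]
        · intro j _ hj
          exact if_neg (by omega)
        · intro hj
          rw [Finset.mem_range] at hj
          omega
    linarith
  have hW : IsBddCompact fun y => interp L N u y + g y :=
    (IsBddCompact.sum _ fun m : ℕ => (isBddCompact_nodalBasis hL hN m).const_mul _).add hg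
  have hWi := hW.integrable_kern_mul hs1
  have h3 : discNegLaplacian h (fun k => ∫ y, kern s (node L N k - y) * (interp L N u y + g y))
      ((i : ℤ) + 1) = ∫ y, h ^ (-1 - 2 * s) * dkern s ((node L N ((i : ℤ) + 1) - y) / h) *
        (interp L N u y + g y) := by
    have i1 : ∀ c d : ℝ, Integrable fun y => kern s (c - y) * (interp L N u y + g y)
        - 2 * (kern s (d - y) * (interp L N u y + g y)) := fun c d =>
      (hWi c).sub ((hWi d).const_mul 2)
    simp only [discNegLaplacian]
    rw [← integral_const_mul, ← integral_sub (hWi _) ((hWi _).const_mul _),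
      ← integral_add (i1 _ _) (hWi _), ← integral_neg, ← integral_div]
    congr 1; ext y
    rw [← second_diff_kern s hh, node_pred, node_succ L N ((i : ℤ) + 1), ← hdef,
      sub_right_comm _ h y, add_sub_right_comm _ h y]
    ring
  rw [h1, ← h3]
  unfold discNegLaplacian
  rw [h2 _ (by omega) (by omega), h2 _ (by omega) (by omega), h2 _ (by omega) (by omega)]
  ring

theorem abs_discNegLaplacian_node_le {L : ℝ} (hL : 0 < L) {N : ℕ} (hN : 0 < N) {u u' : ℝ → ℝ}
    {a b K p : ℝ} (hab : Icc (-L) L ⊆ Icc a b)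
    (h : ∀ x ∈ Icc a b, ∀ y ∈ Icc a b, |u y - u x - u' x * (y - x)| ≤ K * |y - x| ^ p)
    {k : ℤ} (h0 : 0 < k) (h1 : k < N) :
    |discNegLaplacian (meshSize L N) (fun k => u (node L N k)) k|
      ≤ 2 * K * meshSize L N ^ p / meshSize L N ^ 2 := by
  have hh := meshSize_pos hL hN
  have m0 := hab (node_mem_Icc hL hN h0.le h1.le)
  have m1 := hab (node_mem_Icc hL hN (k := k - 1) (by omega) (by omega))
  have m2 := hab (node_mem_Icc hL hN (k := k + 1) (by omega) (by omega))
  rw [node_pred] at m1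
  rw [node_succ] at m2
  have := abs_second_diff_le h m0 m1 m2
  rw [abs_of_pos hh] at this
  simp only [discNegLaplacian]
  rw [node_pred, node_succ, abs_div, abs_of_pos (pow_pos hh 2)]
  refine div_le_div_of_nonneg_right (le_trans (le_of_eq ?_) this) (pow_pos hh 2).le
  congr 1; ring

/-- The bound on second differences extends from `|z| ≤ δ` to almost all `z`, with a constant
independent of the point `x`. -/
theorem exists_second_diff_bound {u : ℝ → ℝ} {L δ M p : ℝ} (hδ : 0 < δ) (hp : 0 ≤ p)
    {K : ℝ} {u' : ℝ → ℝ}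
    (hK : ∀ x ∈ Icc (-L - δ) (L + δ), ∀ y ∈ Icc (-L - δ) (L + δ),
      |u y - u x - u' x * (y - x)| ≤ K * |y - x| ^ p) (hK0 : 0 ≤ K)
    (hu : ContinuousOn u (Icc (-L) L)) (hM : ∀ᵐ y, |u y| ≤ M) :
    ∃ A ≥ 0, ∀ x ∈ Icc (-L) L, ∀ᵐ z, |2 * u x - u (x - z) - u (x + z)| ≤ 2 * A * |z| ^ p := by
  obtain ⟨M', hM'⟩ := isCompact_Icc.exists_bound_of_continuousOn hu
  have hδp : 0 < δ ^ p := Real.rpow_pos_of_pos hδ p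
  refine ⟨K + (|M| + |M'|) / δ ^ p, by positivity, fun x hx => ?_⟩
  have hQm := (volume.measurePreserving_sub_left x).quasiMeasurePreserving
  have hQp := (measurePreserving_add_left volume x).quasiMeasurePreserving
  filter_upwards [hQm.ae hM, hQp.ae hM] with z h1 h2
  have hzp : 0 ≤ |z| ^ p := Real.rpow_nonneg (abs_nonneg z) p
  rcases le_or_gt |z| δ with hz | hz
  · have hz' := abs_le.1 hz
    have := abs_second_diff_le hK (x := x) (z := z) ⟨by linarith [hx.1], by linarith [hx.2]⟩
      ⟨by linarith [hx.1], by linarith [hx.2]⟩ ⟨by linarith [hx.1], by linarith [hx.2]⟩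
    refine this.trans (mul_le_mul_of_nonneg_right ?_ hzp)
    have : 0 ≤ (|M| + |M'|) / δ ^ p := by positivity
    linarith
  · -- away from the diagonal the boundedness of `u` suffices
    have h3 : |2 * u x - u (x - z) - u (x + z)| ≤ 2 * (|M| + |M'|) := by
      have h4 : |u x| ≤ |M'| := (hM' x hx).trans (le_abs_self _)
      have h5 := h1.trans (le_abs_self M)
      have h6 := h2.trans (le_abs_self M)
      rw [abs_le] at *
      constructor <;> linarith [h4.1, h4.2, h5.1, h5.2, h6.1, h6.2]
    have h7 : 1 ≤ |z| ^ p / δ ^ p :=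
      (one_le_div hδp).2 (Real.rpow_le_rpow hδ.le hz.le hp)
    calc _ ≤ 2 * (|M| + |M'|) * 1 := by rw [mul_one]; exact h3
      _ ≤ 2 * (|M| + |M'|) * (|z| ^ p / δ ^ p) :=
          mul_le_mul_of_nonneg_left h7 (by positivity)
      _ = 2 * ((|M| + |M'|) / δ ^ p) * |z| ^ p := by ring
      _ ≤ _ := by
          refine mul_le_mul_of_nonneg_right ?_ hzp
          linarith

/-- Consistency of the scheme: the exact solution leaves a residual of order `h^{1+α-2s}`. -/
theorem exists_residual_bound {s : ℝ} (hs0 : 0 < s) (hs1 : s < 1) (hs : s ≠ 1 / 2)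
    {L δ : ℝ} (hL : 0 < L) (hδ : 0 < δ) {α : ℝ≥0} (hα0 : max 0 (2 * s - 1) < (α : ℝ))
    (hα1 : α ≤ 1) {f g u : ℝ → ℝ}
    (hg0 : ∀ x ∈ Ioo (-L) L, g x = 0) (hg : MemLp g ⊤ volume)
    (hgs : Bornology.IsBounded (Function.support g)) (hu : IsDirichletSolution s L f g u)
    (hreg : IsC1Holder α u (-L - δ) (L + δ)) :
    ∃ C ≥ 0, ∀ N : ℕ, 0 < N →
      ‖(schemeMatrix s L N).mulVec (nodalValues L N u) + boundaryVector s L N g u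
        - nodalValues L N f‖ ≤ C * meshSize L N ^ (1 + (α : ℝ) - 2 * s) := by
  have hα0' : 0 < (α : ℝ) := (le_max_left _ _).trans_lt hα0
  have hα' : 2 * s - 1 < (α : ℝ) := (le_max_right _ _).trans_lt hα0
  have hα1' : (α : ℝ) ≤ 1 := by exact_mod_cast hα1
  have hsub : Icc (-L) L ⊆ Icc (-L - δ) (L + δ) := Icc_subset_Icc (by linarith) (by linarith)
  have hcont : ContinuousOn u (Icc (-L) L) := hreg.1.continuousOn.mono hsub
  have huB := isBddCompact_solution hg hgs hcont hu.2
  have hgB : IsBddCompact g := by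
    obtain ⟨r, hr⟩ := hgs.subset_closedBall 0
    rw [Real.closedBall_eq_Icc] at hr
    exact ⟨hg.1, exists_ae_bound_of_memLp_top hg, _, _, hr⟩
  obtain ⟨M, hM⟩ := huB.bdd
  obtain ⟨K, hK0, u', hK⟩ := hreg.exists_taylor_bound
  obtain ⟨A, hA0, hA⟩ := exists_second_diff_bound hδ (by positivity) hK hK0 hcont hM
  set D₁ := ∫ t, |dkern s t|
  set D₂ := ∫ t, kernDefect s t * |t| ^ (1 + (α : ℝ))
  have hD₁ : 0 ≤ D₁ := integral_nonneg fun t => abs_nonneg _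
  have hD₂ : 0 ≤ D₂ := by
    refine integral_nonneg fun t => mul_nonneg (add_nonneg (abs_nonneg _) ?_)
      (Real.rpow_nonneg (abs_nonneg _) _)
    exact indicator_nonneg (fun t _ => mul_nonneg (fracConst_pos hs0 hs1).le
      (Real.rpow_nonneg (abs_nonneg _) _)) _
  -- the change of the central weight for mesh size one
  set c₀ := omegaBarM s 1 0 - omegaBar s 1 0
  refine ⟨A * D₂ + K * D₁ + |c₀| * (2 * K), by positivity, fun N hN => ?_⟩
  set h := meshSize L N with hdef
  have hh : 0 < h := meshSize_pos hL hN
  refine (pi_norm_le_iff_of_nonneg (by positivity)).2 fun i => ?_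
  have hi := i.2
  set x := node L N ((i : ℤ) + 1) with hx
  have hxI : x ∈ Ioo (-L) L := by
    constructor
    · rw [← node_zero L N]; exact node_mono hL hN (by omega)
    · exact (node_mono hL hN (by omega : (i : ℤ) + 1 < N)).trans_eq (node_last L hN)
  -- the interpolation error, which is supported in `[-L, L]`
  have he : ∀ᵐ y, |interp L N u y + g y - u y| ≤ K * h ^ (1 + (α : ℝ)) := by
    filter_upwards [compl_mem_ae_iff.2 (measure_singleton (-L)),
      compl_mem_ae_iff.2 (measure_singleton L)] with y hy1 hy2
    by_cases hy : y ∈ Icc (-L) L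
    · have hy' : y ∈ Ioo (-L) L := ⟨lt_of_le_of_ne hy.1 (Ne.symm hy1), lt_of_le_of_ne hy.2 hy2⟩
      rw [hg0 y hy', add_zero]
      exact abs_interp_sub_le hL hN hK0 (by positivity) hsub hK hy'
    · have : interp L N u y = 0 :=
        Finset.sum_eq_zero fun k _ => by rw [nodalBasis_eq_zero hy, mul_zero]
      rw [this, hu.2 y hy, zero_add, sub_self, abs_zero]
      positivity
  have hWB : IsBddCompact fun y => interp L N u y + g y :=
    (IsBddCompact.sum _ fun m : ℕ => (isBddCompact_nodalBasis hL hN m).const_mul _).add hgB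
  have hdk : Integrable fun y => h ^ (-1 - 2 * s) * dkern s ((x - y) / h) :=
    (integrable_comp_sub_div hh (integrable_dkern hs0 hs1 hs) x).const_mul _
  have i1 : Integrable fun y => h ^ (-1 - 2 * s) * dkern s ((x - y) / h) * u y :=
    hdk.mul_bdd huB.aesm hM
  have i2 : Integrable fun y =>
      h ^ (-1 - 2 * s) * dkern s ((x - y) / h) * (interp L N u y + g y - u y) :=
    hdk.mul_bdd (hWB.aesm.sub huB.aesm) he
  have hsplit : ∫ y, h ^ (-1 - 2 * s) * dkern s ((x - y) / h) * (interp L N u y + g y)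
      = (∫ y, h ^ (-1 - 2 * s) * dkern s ((x - y) / h) * u y)
        + ∫ y, h ^ (-1 - 2 * s) * dkern s ((x - y) / h) * (interp L N u y + g y - u y) := by
    rw [← integral_add i1 i2]
    congr 1; ext y; ring
  have b1 := abs_fracLaplacian_sub_le hs0 hs1 hs hh hα0' hα' hα1' huB.aesm hM
    (hA x (Ioo_subset_Icc_self hxI)) (hu.1 x hxI)
  have b2 := abs_integral_dkern_mul_le hs0 hs1 hs hh he x
  have b3 := abs_discNegLaplacian_node_le hL hN hsub hK (k := (i : ℤ) + 1) (by omega) (by omega)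
  rw [← hdef] at b3
  have hc₀ : omegaBarM s h 0 - omegaBar s h 0 = h ^ (2 - 2 * s) * c₀ := by
    rw [omegaBarM_scale s hh, omegaBar_scale s hh]; ring
  have e1 : h ^ (1 + (α : ℝ)) * h ^ (-(2 * s)) = h ^ (1 + (α : ℝ) - 2 * s) := by
    rw [← Real.rpow_add hh]; congr 1
  have e2 : h ^ (2 - 2 * s) * (h ^ (1 + (α : ℝ)) / h ^ 2) = h ^ (1 + (α : ℝ) - 2 * s) := by
    rw [← Real.rpow_natCast h 2, ← Real.rpow_sub hh, ← Real.rpow_add hh]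
    congr 1; push_cast; ring
  have hpos : 0 < h ^ (2 - 2 * s) := Real.rpow_pos_of_pos hh _
  rw [Pi.sub_apply, schemeMatrix_mulVec_add hs1 hL hN hgB, ← hdef, ← hx, hsplit, hc₀,
    Real.norm_eq_abs, nodalValues, ← hx]
  set T := ∫ y, h ^ (-1 - 2 * s) * dkern s ((x - y) / h) * u y
  set T' := ∫ y, h ^ (-1 - 2 * s) * dkern s ((x - y) / h) * (interp L N u y + g y - u y)
  set Δ := discNegLaplacian h (fun k => u (node L N k)) ((i : ℤ) + 1)
  have b4 : |h ^ (2 - 2 * s) * c₀ * Δ| ≤ |c₀| * (2 * K) * h ^ (1 + (α : ℝ) - 2 * s) := by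
    rw [abs_mul, abs_mul, abs_of_pos hpos, ← e2]
    calc _ ≤ h ^ (2 - 2 * s) * |c₀| * (2 * K * h ^ (1 + (α : ℝ)) / h ^ 2) := by gcongr
      _ = _ := by ring
  have b2' : |T'| ≤ K * D₁ * h ^ (1 + (α : ℝ) - 2 * s) := by
    refine b2.trans_eq ?_
    rw [← e1]; ring
  have b1' : |T - f x| ≤ A * D₂ * h ^ (1 + (α : ℝ) - 2 * s) := by
    rw [abs_sub_comm]
    exact b1.trans_eq (by ring)
  calc |T + T' + h ^ (2 - 2 * s) * c₀ * Δ - f x|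
      = |(T - f x) + T' + h ^ (2 - 2 * s) * c₀ * Δ| := by congr 1; ring
    _ ≤ |T - f x| + |T'| + |h ^ (2 - 2 * s) * c₀ * Δ| := abs_add_three _ _ _
    _ ≤ _ := by linarith

end FracDirichlet

/-! ### Convergence -/

theorem mainTheorem2 (s : ℝ) (hs0 : 0 < s) (hs1 : s < 1) (hs : s ≠ 1 / 2)
    (L δ : ℝ) (hL : 0 < L) (hδ : 0 < δ)
    (α : ℝ≥0) (hα0 : max 0 (2 * s - 1) < (α : ℝ)) (hα1 : α ≤ 1)
    (f g u : ℝ → ℝ)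
    (hg0 : ∀ x ∈ Ioo (-L) L, g x = 0) (hg : MemLp g ⊤ volume)
    (hgs : Bornology.IsBounded (Function.support g))
    (hu : IsDirichletSolution s L f g u)
    (hreg : IsC1Holder α u (-L - δ) (L + δ)) :
    ∃ C > 0, ∀ N : ℕ, 0 < N → 4 * meshSize L N < δ →
      (∃! Uh : Fin (N - 1) → ℝ,
        (schemeMatrix s L N).mulVec Uh + boundaryVector s L N g u = nodalValues L N f) ∧
      ∀ Uh : Fin (N - 1) → ℝ,
        (schemeMatrix s L N).mulVec Uh + boundaryVector s L N g u = nodalValues L N f →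
        ‖nodalValues L N u - Uh‖ < C * meshSize L N ^ (1 + (α : ℝ) - 2 * s) ∧
        discL2Norm (meshSize L N) (nodalValues L N u - Uh) <
          C * meshSize L N ^ (1 + (α : ℝ) - 2 * s) := by
  obtain ⟨r, hr, hstab⟩ := exists_stability hs0 hs1 hs hL
  obtain ⟨C, hC, hres⟩ := exists_residual_bound hs0 hs1 hs hL hδ hα0 hα1 hg0 hg hgs hu hreg
  have hq : 0 ≤ Real.sqrt (2 * L) := Real.sqrt_nonneg _
  have hCr : 0 ≤ C / r := div_nonneg hC hr.le
  refine ⟨(C / r + 1) * (1 + Real.sqrt (2 * L)), by positivity, fun N hN _ =>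
    ⟨existsUnique_of_stability hr (hstab N hN) _ _, fun Uh hUh => ?_⟩⟩
  have hh := meshSize_pos hL hN
  have hp : 0 < meshSize L N ^ (1 + (α : ℝ) - 2 * s) := Real.rpow_pos_of_pos hh _
  have herr : ‖nodalValues L N u - Uh‖ ≤ C / r * meshSize L N ^ (1 + (α : ℝ) - 2 * s) := by
    -- `B₁ (U - U_h)` is the residual of the exact nodal values
    have h1 := (hstab N hN (nodalValues L N u - Uh)).trans_eq (congrArg norm
      (show _ = (schemeMatrix s L N).mulVec (nodalValues L N u) + boundaryVector s L N g u
        - nodalValues L N f by rw [Matrix.mulVec_sub, ← hUh]; abel))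
    rw [div_mul_eq_mul_div, le_div_iff₀ hr, mul_comm]
    exact h1.trans (hres N hN)
  have hlt : ‖nodalValues L N u - Uh‖
      < (C / r + 1) * meshSize L N ^ (1 + (α : ℝ) - 2 * s) := herr.trans_lt (by linarith)
  have hNh : meshSize L N * (N - 1 : ℕ) ≤ 2 * L := by
    have hN' : (0 : ℝ) < N := by exact_mod_cast hN
    have h1 : ((N - 1 : ℕ) : ℝ) ≤ N := by exact_mod_cast Nat.sub_le N 1
    calc meshSize L N * (N - 1 : ℕ) ≤ meshSize L N * N := by gcongr
      _ = 2 * L := div_mul_cancel₀ _ hN'.ne'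
  have hl2 := discL2Norm_le hh.le hNh (nodalValues L N u - Uh)
  constructor
  · refine hlt.trans_le (mul_le_mul_of_nonneg_right ?_ hp.le)
    exact le_mul_of_one_le_right (by positivity) (by linarith)
  · calc discL2Norm (meshSize L N) (nodalValues L N u - Uh)
        ≤ Real.sqrt (2 * L) * ‖nodalValues L N u - Uh‖ := hl2
      _ ≤ Real.sqrt (2 * L) * ((C / r + 1) * meshSize L N ^ (1 + (α : ℝ) - 2 * s)) := by gcongr
      _ < (1 + Real.sqrt (2 * L)) * ((C / r + 1) * meshSize L N ^ (1 + (α : ℝ) - 2 * s)) := by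
          refine mul_lt_mul_of_pos_right (by linarith) (by positivity)
      _ = _ := by ring
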